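/- Let $r\ge 2$, $q=e^{\pi \mathsf i/r}$, $q^{1/2}=e^{\pi\mathsf i/2r}$, $s=q^{r-1}$, and write $\{x\}=q^x-q^{-x}$, $[x]=\{x\}/\{1\}$, $\{a\}!=\{a\}\{a-1\}\cdots\{1\}$. Let $\mathsf V=\mathsf V_{r-1}$ be the $r$-dimensional complex vector space with basis $u_0,\dots,u_{r-1}$ and operators $$k\,u_m=q^{(r-1-2m)/2}u_m,\qquad E\,u_m=u_{m-1},\qquad F\,u_m=[m+1][r-1-m]\,u_{m+1},\qquad u_{-1}=u_r=0 .$$ Let $n\ge 1$. On $\mathsf V^{\otimes n}$ let $E$ and $F$ act by $$E=\sum_{i=1}^n 1^{\otimes i-1}\otimes E\otimes (k^2)^{\otimes n-i},\qquad F=\sum_{i=1}^n (k^{-2})^{\otimes i-1}\otimes F\otimes 1^{\otimes n-i}.$$ For $\ell\in\mathbb N$ let $\boldsymbol V_{n,\ell}\subset \mathsf V^{\otimes n}$ be the span of the vectors $u_{\varepsilon_1}\otimes\cdots\otimes u_{\varepsilon_n}$ with $\varepsilon_1+\cdots+\varepsilon_n=\ell$ (equivalently, the eigenspace for the eigenvalue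 $n(r-1)-2\ell$ of $\sum_i 1^{\otimes i-1}\otimes H\otimes 1^{\otimes n-i}$, where $H u_m=(r-1-2m)u_m$), and put $$\boldsymbol W_{n,\ell}=\ker E\cap \boldsymbol V_{n,\ell},\qquad \boldsymbol N_{n,\ell}=\ker (FE)^2\cap \boldsymbol V_{n,\ell}.$$ Let $$R=\frac1{4r}\sum_{a=0}^{r-1}\sum_{m,m'=0}^{4r-1}\frac{\{1\}^{2a}}{\{a\}!}\,q^{a(a-1)/2+a(m-m')-mm'/2}\;E^ak^m\otimes F^ak^{m'},\qquad \mathsf R=q^{-(r-1)^2/2}\,\tau\circ R$$ on $\mathsf V\otimes\mathsf V$, where $\tau$ is the flip. Then the operators $1^{\otimes i-1}\otimes\mathsf R\otimes 1^{\otimes n-i-1}$, $1\le i\le n-1$, define a representation of the braid group $B_n$ (with Artin generators $\sigma_1,\dots,\sigma_{n-1}$) on $\mathsf V^{\otimes n}$, for which $\boldsymbol W_{n,\ell}$ and $\boldsymbol N_{n,\ell}$ are subrepresentations. Let $\delta_i=\sigma_1\sigma_2\cdots\sigma_{i-1}$ for $2\le i\le n$, let $\Delta_n=\delta_n\delta_{n-1}\cdots\delta_2$,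 and let $\theta_n=\Delta_n^2$ be the full twist. Let $0\le j<r$ be the solution of $j\equiv n+2(\ell-1) \bmod r$ and let $\ell'=\ell-1-j\in\mathbb Z$. Then: 1. If $j<r-1$, the full twist acts on $\boldsymbol N_{n,\ell}$ by $$\theta_n=q^{2\ell(n+\ell-1)}\Bigl(\mathrm{Id}+s^n q^{1-\ell-\ell'}(\ell-\ell')\frac{\{1\}^2}{\{\ell-\ell'\}}\,FE\Bigr).$$ If $j=r-1$ (so that $\{\ell-\ell'\}=\{r\}=0$), then $FE$ vanishes on $\boldsymbol N_{n,\ell}$ and $\theta_n$ acts on $\boldsymbol N_{n,\ell}$ by the scalar $q^{2\ell(n+\ell-1)}$. 2. The full twist acts on $\boldsymbol W_{n,\ell}$ by the scalar $q^{2\ell(n+\ell-1)}$, whose $r$-th power is $1$. Hence $\theta_n^r$ acts trivially on $\boldsymbol W_{n,\ell}$, and if $n\ge 2$, the representation $\boldsymbol W_{n,\ell}$ of $B_n$ is not faithful. -/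

import Mathlib

noncomputable section

/-! ### The Artin braid group -/

/-- Artin's relators on the generators `σ_1, …, σ_{n-1}`; the index `i : Fin (n - 1)` stands for
the generator `σ_{i+1}`. -/
def braidRels (n : ℕ) : Set (FreeGroup (Fin (n - 1))) :=
  {x | ∃ i j : Fin (n - 1), (i : ℕ) + 1 < j ∧
      x = FreeGroup.of i * FreeGroup.of j * (FreeGroup.of j * FreeGroup.of i)⁻¹} ∪
  {x | ∃ i j : Fin (n - 1), (i : ℕ) + 1 = j ∧
      x = FreeGroup.of i * FreeGroup.of j * FreeGroup.of i *
        (FreeGroup.of j * FreeGroup.of i * FreeGroup.of j)⁻¹}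

/-- The braid group `B_n` on `n` strands. -/
abbrev BraidGroup (n : ℕ) : Type := PresentedGroup (braidRels n)

namespace BraidGroup

/-- The generator `σ_{i+1}` of `B_n`. -/
def gen (n : ℕ) (i : Fin (n - 1)) : BraidGroup n := PresentedGroup.of i

/-- `δ_i = σ_1 σ_2 ⋯ σ_{i-1}` for `2 ≤ i ≤ n`. -/
def delta (n i : ℕ) : BraidGroup n :=
  (((List.finRange (n - 1)).take (i - 1)).map (gen n)).prod

/-- The half twist `Δ_n = δ_n δ_{n-1} ⋯ δ_2`. -/
def halfTwist (n : ℕ) : BraidGroup n :=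
  ((List.range (n - 1)).map fun t => delta n (n - t)).prod

/-- The full twist `θ_n = Δ_n ^ 2`. -/
def fullTwist (n : ℕ) : BraidGroup n := halfTwist n ^ 2

end BraidGroup

namespace Steinberg

/-! ### Quantum numbers at the root of unity -/

/-- `q^{1/2} = exp(π i / (2r))`. -/
def qHalf (r : ℕ) : ℂ := Complex.exp (Real.pi * Complex.I / (2 * r))

/-- `q = exp(π i / r)`. -/
def q (r : ℕ) : ℂ := Complex.exp (Real.pi * Complex.I / r)

/-- `s = q^{r-1}`. -/
def s (r : ℕ) : ℂ := q r ^ (r - 1)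

/-- `{x} = q^x - q^{-x}`. -/
def qNum (r : ℕ) (x : ℤ) : ℂ := q r ^ x - q r ^ (-x)

/-- `[x] = {x} / {1}`. -/
def qInt (r : ℕ) (x : ℤ) : ℂ := qNum r x / qNum r 1

/-- `{a}! = {a} {a-1} ⋯ {1}`. -/
def qNumFactorial (r a : ℕ) : ℂ := ∏ t ∈ Finset.range a, qNum r (t + 1)

/-! ### The Steinberg module `V_{r-1}` with the actions of `E`, `F`, `k`, `k⁻¹` and of the strong
weight operator `H` -/

/-- The underlying space of the `r`-dimensional module `V_{r-1}`. -/
abbrev V (r : ℕ) : Type := Fin r → ℂ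

/-- The basis vector `u_m`, `0 ≤ m ≤ r - 1`; it is `0` for `m ≥ r`. -/
def u (r m : ℕ) : V r := fun t => if (t : ℕ) = m then 1 else 0

/-- The endomorphism of `V_{r-1}` with `u_m ↦ f m` for `0 ≤ m ≤ r - 1`. -/
def onBasis (r : ℕ) (f : ℕ → V r) : Module.End ℂ (V r) :=
  (Pi.basisFun ℂ (Fin r)).constr ℂ fun m => f m

/-- `E u_m = u_{m-1}`, with `u_{-1} = 0`. -/
def opE (r : ℕ) : Module.End ℂ (V r) :=
  onBasis r fun m => if m = 0 then 0 else u r (m - 1)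

/-- `F u_m = [m+1] [r-1-m] u_{m+1}`, with `u_r = 0`. -/
def opF (r : ℕ) : Module.End ℂ (V r) :=
  onBasis r fun m => (qInt r (m + 1) * qInt r ((r : ℤ) - 1 - m)) • u r (m + 1)

/-- `k u_m = q^{(r-1-2m)/2} u_m`. -/
def opK (r : ℕ) : Module.End ℂ (V r) :=
  onBasis r fun m => (qHalf r ^ ((r : ℤ) - 1 - 2 * m)) • u r m

/-- `k⁻¹ u_m = q^{-(r-1-2m)/2} u_m`. -/
def opKInv (r : ℕ) : Module.End ℂ (V r) :=
  onBasis r fun m => (qHalf r ^ (-((r : ℤ) - 1 - 2 * m))) • u r m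

/-- `H u_m = (r-1-2m) u_m`. -/
def opH (r : ℕ) : Module.End ℂ (V r) :=
  onBasis r fun m => ((r : ℂ) - 1 - 2 * m) • u r m

/-! ### The tensor power `V_{r-1}^{⊗ n}` -/

/-- `V_{r-1}^{⊗ n}`. -/
abbrev TensorPow (n r : ℕ) : Type := PiTensorProduct ℂ fun _ : Fin n => V r

/-- `∑_i a^{⊗ (i-1)} ⊗ x ⊗ b^{⊗ (n-i)}`. -/
def sumInsert (n r : ℕ) (a x b : Module.End ℂ (V r)) : Module.End ℂ (TensorPow n r) :=
  ∑ i : Fin n, PiTensorProduct.map fun p : Fin n => if p < i then a else if p = i then x else b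

/-- The action of `E` on `V_{r-1}^{⊗ n}`, through the iterated coproduct of
`Δ(E) = 1 ⊗ E + E ⊗ k²`. -/
def tensorE (n r : ℕ) : Module.End ℂ (TensorPow n r) := sumInsert n r 1 (opE r) (opK r ^ 2)

/-- The action of `F` on `V_{r-1}^{⊗ n}`, through the iterated coproduct of
`Δ(F) = k⁻² ⊗ F + F ⊗ 1`. -/
def tensorF (n r : ℕ) : Module.End ℂ (TensorPow n r) := sumInsert n r (opKInv r ^ 2) (opF r) 1

/-- The operator `H_n = ∑_i 1^{⊗ (i-1)} ⊗ H ⊗ 1^{⊗ (n-i)}`. -/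
def tensorH (n r : ℕ) : Module.End ℂ (TensorPow n r) := sumInsert n r 1 (opH r) 1

/-- The strong weight space `V_{n,ℓ} = ker (H_n - (n(r-1) - 2ℓ))`. -/
def weightSpace (n r ℓ : ℕ) : Submodule ℂ (TensorPow n r) :=
  LinearMap.ker (tensorH n r - ((n : ℂ) * ((r : ℂ) - 1) - 2 * ℓ) • 1)

/-- The highest strong weight space `W_{n,ℓ} = ker E ∩ V_{n,ℓ}`. -/
def highestWeightSpace (n r ℓ : ℕ) : Submodule ℂ (TensorPow n r) :=
  LinearMap.ker (tensorE n r) ⊓ weightSpace n r ℓ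

/-- The dominant space `N_{n,ℓ} = ker (FE)² ∩ V_{n,ℓ}`. -/
def dominantSpace (n r ℓ : ℕ) : Submodule ℂ (TensorPow n r) :=
  LinearMap.ker ((tensorF n r * tensorE n r) ^ 2) ⊓ weightSpace n r ℓ

/-! ### The braiding -/

/-- The coefficient of `E^a k^m ⊗ F^a k^{m'}` in the universal `R`-matrix
`R = (1/4r) ∑_{a=0}^{r-1} ∑_{m,m'=0}^{4r-1}
  ({1}^{2a} / {a}!) q^{a(a-1)/2 + a(m-m') - m m'/2} E^a k^m ⊗ F^a k^{m'}`. -/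
def coeffR (r a m m' : ℕ) : ℂ :=
  1 / (4 * r) * (qNum r 1 ^ (2 * a) / qNumFactorial r a) *
    qHalf r ^ ((a : ℤ) * (a - 1) + 2 * a * ((m : ℤ) - m') - m * m')

/-- The position `i` (of `0, …, n - 1`) of the left strand of the crossing `σ_{i+1}`. -/
def leftPos {n : ℕ} (i : Fin (n - 1)) : Fin n := ⟨i, by omega⟩

/-- The position of the right strand of the crossing `σ_{i+1}`. -/
def rightPos {n : ℕ} (i : Fin (n - 1)) : Fin n := ⟨i + 1, by omega⟩

/-- `1 ⊗ ⋯ ⊗ 1 ⊗ x ⊗ y ⊗ 1 ⊗ ⋯ ⊗ 1` with `x`, `y` on the two strands of the crossing. -/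
def twoLegs {n : ℕ} (r : ℕ) (i : Fin (n - 1)) (x y : Module.End ℂ (V r)) :
    Module.End ℂ (TensorPow n r) :=
  PiTensorProduct.map fun p : Fin n => if p = leftPos i then x else if p = rightPos i then y else 1

/-- `R` acting on the two adjacent tensor factors of the crossing. -/
def tensorR {n : ℕ} (r : ℕ) (i : Fin (n - 1)) : Module.End ℂ (TensorPow n r) :=
  ∑ a ∈ Finset.range r, ∑ m ∈ Finset.range (4 * r), ∑ m' ∈ Finset.range (4 * r),
    coeffR r a m m' • twoLegs r i (opE r ^ a * opK r ^ m) (opF r ^ a * opK r ^ m')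

/-- The flip `τ` of the two adjacent tensor factors of the crossing. -/
def tensorFlip {n : ℕ} (r : ℕ) (i : Fin (n - 1)) : Module.End ℂ (TensorPow n r) :=
  (PiTensorProduct.reindex ℂ (fun _ : Fin n => V r)
    (Equiv.swap (leftPos i) (rightPos i))).toLinearMap

/-- The operator `1^{⊗ i} ⊗ 𝖱 ⊗ 1^{⊗ (n-i-2)}` by which the generator `σ_{i+1}` acts, where
`𝖱 = q^{-(r-1)²/2} τ ∘ R` on `V_{r-1} ⊗ V_{r-1}`. -/
def sigmaOp (n r : ℕ) (i : Fin (n - 1)) : Module.End ℂ (TensorPow n r) :=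
  qHalf r ^ (-((r : ℤ) - 1) ^ 2) • (tensorFlip r i * tensorR r i)

end Steinberg

end

/-! On weight vectors the Cartan part of `R` is a Gauss sum over the powers of `k`, and the braiding
becomes `u_m ⊗ u_p ↦ ∑_a c_a F^a u_p ⊗ E^a u_m` (`sigmaOp_zero_cons`). It preserves the total degree
and commutes with `E` and `F`, by two scalar recursions for `c_a`. Hence the kernels of `E` and of
`(FE)²` in each weight space are invariant.

The main device is that `u_0` generates `V` under `F`: since `F u_m = [m+1]² u_{m+1}` with nonzero
coefficient for `m + 1 < r`, an operator commuting with `F` is determined by its values on `u_0 ⊗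
V^{⊗ n}` (`hom_ext_tensorF`). As `E u_0 = 0`, braiding `u_0` past another vector only swaps them, up
to a power of `q`. This gives the Yang–Baxter equation and, by a similar argument, the invertibility
of the braiding.

The same device computes the full twist. One has `θ_{n+1} = (1 ⊗ θ_n) · (σ_1 ⋯ σ_n)(σ_n ⋯ σ_1)`
(`halfTwistProd_succ_sq`). Winding `u_0` around `x` yields `∑_c w_c F^c u_0 ⊗ E^c x`
(`windOp_cons`), and with the `q`-binomial formula, induction on `n` gives `θ_n = ∑_{a<r} t_a F^a
E^a` on `V_{n,ℓ}` (`fullTwistOp_apply`).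

On `ker E` only `a = 0` survives, which gives the scalar of part 2. On `ker (FE)²` each `F^{a+1}
E^{a+1}` is an explicit multiple of `FE`, with coefficient `∏_{i<a} (-[i+1][y+i])`, where `y =
n(r-1) - 2(ℓ-1) ≡ -j` modulo `r`. If `j < r - 1`, the product vanishes once `a > j`, and the
remaining sum is `(j+1)/{j+1}` up to explicit factors, by a telescoping identity
(`sum_prod_qNum_div`). If `j = r - 1`, the product for `a = r - 1` is nonzero while `E^r = 0`, so
`FE` vanishes.

For non-faithfulness, `θ_n^r` acts trivially on `W_{n,ℓ}` but has positive exponent sum under `B_n →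
ℤ`, so it is not `1`. -/

namespace Steinberg

/-! ### Scalars -/

theorem qHalf_ne_zero (r : ℕ) : qHalf r ≠ 0 := Complex.exp_ne_zero _

theorem q_eq_qHalf_sq (r : ℕ) : q r = qHalf r ^ 2 := by
  rw [q, qHalf, ← Complex.exp_nat_mul]
  congr 1
  push_cast
  ring

theorem q_zpow (r : ℕ) (x : ℤ) : q r ^ x = qHalf r ^ (2 * x) := by
  rw [q_eq_qHalf_sq, zpow_mul]
  norm_cast

theorem s_zpow {r : ℕ} (hr : 2 ≤ r) (x : ℤ) : s r ^ x = qHalf r ^ (2 * ((r : ℤ) - 1) * x) := by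
  rw [s, ← zpow_natCast, q_zpow, ← zpow_mul]
  congr 1
  push_cast [Nat.cast_sub (show 1 ≤ r by omega)]
  ring

theorem qHalf_pow_two_mul {r : ℕ} (hr : 2 ≤ r) : qHalf r ^ (2 * r) = -1 := by
  have hr0 : (r : ℂ) ≠ 0 := by norm_cast; omega
  rw [qHalf, ← Complex.exp_nat_mul, ← Complex.exp_pi_mul_I]
  congr 1
  push_cast
  field_simp

theorem qHalf_zpow_add {r : ℕ} (hr : 2 ≤ r) (x : ℤ) :
    qHalf r ^ (x + 2 * r) = -qHalf r ^ x := by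
  have h := qHalf_pow_two_mul hr
  rw [zpow_add₀ (qHalf_ne_zero r), show (2 * r : ℤ) = ((2 * r : ℕ) : ℤ) by push_cast; ring,
    zpow_natCast, h]
  ring

theorem qHalf_zpow_add_mul {r : ℕ} (hr : 2 ≤ r) (x t : ℤ) :
    qHalf r ^ (x + 4 * r * t) = qHalf r ^ x := by
  have h := qHalf_zpow_add hr
  rw [zpow_add₀ (qHalf_ne_zero r), zpow_mul, show (4 * r : ℤ) = 0 + 2 * r + 2 * r by ring, h, h]
  simp

theorem isPrimitiveRoot_qHalf {r : ℕ} (hr : 2 ≤ r) : IsPrimitiveRoot (qHalf r) (4 * r) := by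
  have h := Complex.isPrimitiveRoot_exp (4 * r) (by omega)
  convert h using 1
  rw [qHalf]
  congr 1
  push_cast
  have hr0 : (r : ℂ) ≠ 0 := by norm_cast; omega
  field_simp
  norm_num

theorem qHalf_zpow_eq_one_iff {r : ℕ} (hr : 2 ≤ r) (x : ℤ) :
    qHalf r ^ x = 1 ↔ (4 * r : ℤ) ∣ x := by
  have := (isPrimitiveRoot_qHalf hr).zpow_eq_one_iff_dvd x
  push_cast at this
  exact this

theorem qNum_eq (r : ℕ) (x : ℤ) : qNum r x = qHalf r ^ (2 * x) - qHalf r ^ (-(2 * x)) := by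
  rw [qNum, q_zpow, q_zpow, mul_neg]

theorem qNum_eq_zero_iff {r : ℕ} (hr : 2 ≤ r) (x : ℤ) : qNum r x = 0 ↔ (r : ℤ) ∣ x := by
  have h0 := qHalf_ne_zero r
  have : qNum r x = qHalf r ^ (-(2 * x)) * (qHalf r ^ (4 * x) - 1) := by
    rw [qNum_eq, mul_sub, ← zpow_add₀ h0, mul_one]
    congr 2
    ring
  rw [this, mul_eq_zero, sub_eq_zero, qHalf_zpow_eq_one_iff hr]
  simp only [zpow_ne_zero _ h0, false_or]
  constructor
  · rintro ⟨c, hc⟩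
    exact ⟨c, by linarith⟩
  · rintro ⟨c, hc⟩
    exact ⟨c, by rw [hc]; ring⟩

theorem qNum_ne_zero {r : ℕ} (hr : 2 ≤ r) {x : ℤ} (h0 : 0 < x) (hx : x < r) : qNum r x ≠ 0 := by
  rw [Ne, qNum_eq_zero_iff hr]
  intro h
  have := Int.le_of_dvd h0 h
  omega

theorem qNum_one_ne_zero {r : ℕ} (hr : 2 ≤ r) : qNum r 1 ≠ 0 :=
  qNum_ne_zero hr one_pos (by omega)

theorem qNum_sub_left {r : ℕ} (hr : 2 ≤ r) (x : ℤ) : qNum r (r - x) = qNum r x := by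
  have h1 := qHalf_zpow_add hr (-(2 * x))
  have h2 := qHalf_zpow_add hr (-(2 * (r - x)))
  rw [show -(2 * ((r : ℤ) - x)) + 2 * r = 2 * x by ring] at h2
  rw [qNum_eq, qNum_eq, show 2 * ((r : ℤ) - x) = -(2 * x) + 2 * r by ring, h1, h2]
  rw [show 2 * ((r : ℤ) - x) = -(2 * x) + 2 * r by ring]
  ring

/-- Since `q^r = -1`, one has `{r - x} = {x}`. This turns the matrix coefficients of `F` into
squares, the form used from here on. -/
theorem qInt_mul_qInt_sub {r : ℕ} (hr : 2 ≤ r) (m : ℕ) :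
    qInt r (m + 1) * qInt r ((r : ℤ) - 1 - m) = qInt r (m + 1) ^ 2 := by
  rw [qInt, qInt, show (r : ℤ) - 1 - m = r - (m + 1) by ring, qNum_sub_left hr]
  ring

theorem qInt_eq_zero_iff {r : ℕ} (hr : 2 ≤ r) (x : ℤ) : qInt r x = 0 ↔ (r : ℤ) ∣ x := by
  rw [qInt, div_eq_zero_iff, qNum_eq_zero_iff hr]
  simp [qNum_one_ne_zero hr]

theorem qNumFactorial_zero (r : ℕ) : qNumFactorial r 0 = 1 := by simp [qNumFactorial]

theorem qNumFactorial_succ (r a : ℕ) :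
    qNumFactorial r (a + 1) = qNumFactorial r a * qNum r (a + 1) := by
  rw [qNumFactorial, Finset.prod_range_succ, ← qNumFactorial]

theorem qNumFactorial_ne_zero {r a : ℕ} (hr : 2 ≤ r) (ha : a < r) : qNumFactorial r a ≠ 0 := by
  rw [qNumFactorial, Finset.prod_ne_zero_iff]
  intro t ht
  rw [Finset.mem_range] at ht
  exact qNum_ne_zero hr (by omega) (by omega)

theorem qNumFactorial_self {r : ℕ} (hr : 2 ≤ r) : qNumFactorial r r = 0 := by
  obtain ⟨a, rfl⟩ : ∃ a, r = a + 1 := ⟨r - 1, by omega⟩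
  rw [qNumFactorial_succ, (qNum_eq_zero_iff hr _).2 (by push_cast; simp), mul_zero]

/-- `∑_{t < 4r} q^{ty/2}` vanishes unless `4r ∣ y`. -/
theorem sum_qHalf_zpow {r : ℕ} (hr : 2 ≤ r) (y : ℤ) :
    ∑ t ∈ Finset.range (4 * r), qHalf r ^ ((t : ℤ) * y) =
      if (4 * r : ℤ) ∣ y then (4 * r : ℂ) else 0 := by
  have h : ∀ t : ℕ, qHalf r ^ ((t : ℤ) * y) = (qHalf r ^ y) ^ t := by
    intro t
    rw [mul_comm, zpow_mul, zpow_natCast]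
  simp_rw [h]
  split_ifs with hy
  · rw [(qHalf_zpow_eq_one_iff hr y).2 hy]
    simp
  · have h1 : qHalf r ^ y ≠ 1 := fun h => hy ((qHalf_zpow_eq_one_iff hr y).1 h)
    rw [geom_sum_eq h1, ← zpow_natCast, ← zpow_mul,
      (qHalf_zpow_eq_one_iff hr _).2 ⟨y, by push_cast; ring⟩]
    simp

/-- The Gauss sum evaluating the Cartan part of the `R`-matrix on a pair of weight vectors. -/
theorem sum_coeffR {r : ℕ} (hr : 2 ≤ r) (a : ℕ) (w w' : ℤ) :
    ∑ m ∈ Finset.range (4 * r), ∑ m' ∈ Finset.range (4 * r),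
      coeffR r a m m' * (qHalf r ^ ((m : ℤ) * w) * qHalf r ^ ((m' : ℤ) * w')) =
    qNum r 1 ^ (2 * a) / qNumFactorial r a *
      qHalf r ^ ((a : ℤ) * (a - 1) + (w + 2 * a) * (w' - 2 * a)) := by
  have h0 := qHalf_ne_zero r
  have hr0 : (4 * r : ℂ) ≠ 0 := by norm_cast; omega
  rw [Finset.sum_comm]
  -- Summing over `m` first is a geometric sum over the `4r`-th roots of unity; it selects the
  -- single `m'` congruent to `w + 2a` modulo `4r`.
  have step : ∀ m' ∈ Finset.range (4 * r), ∑ m ∈ Finset.range (4 * r),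
      coeffR r a m m' * (qHalf r ^ ((m : ℤ) * w) * qHalf r ^ ((m' : ℤ) * w')) =
      if m' = ((w + 2 * a) % (4 * r)).toNat then
        qNum r 1 ^ (2 * a) / qNumFactorial r a *
          qHalf r ^ ((a : ℤ) * (a - 1) + (w + 2 * a) * (w' - 2 * a)) else 0 := by
    intro m' hm'
    rw [Finset.mem_range] at hm'
    have : ∀ m : ℕ, coeffR r a m m' * (qHalf r ^ ((m : ℤ) * w) * qHalf r ^ ((m' : ℤ) * w')) =
        (1 / (4 * r) * (qNum r 1 ^ (2 * a) / qNumFactorial r a) *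
          qHalf r ^ ((a : ℤ) * (a - 1) + m' * (w' - 2 * a))) *
          qHalf r ^ ((m : ℤ) * (w + 2 * a - m')) := by
      intro m
      rw [coeffR, mul_assoc _ (_ ^ _), mul_assoc _ (_ ^ _), ← zpow_add₀ h0, ← zpow_add₀ h0,
        ← zpow_add₀ h0]
      congr 2
      ring
    simp_rw [this]
    rw [← Finset.mul_sum, sum_qHalf_zpow hr]
    have hiff : (4 * r : ℤ) ∣ w + 2 * a - m' ↔ m' = ((w + 2 * a) % (4 * r)).toNat := by
      have hpos : (0 : ℤ) < 4 * r := by omega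
      have h1 := Int.emod_nonneg (w + 2 * a) hpos.ne'
      have h2 := Int.emod_lt_of_pos (w + 2 * a) hpos
      have h3 : (m' : ℤ) % (4 * r) = m' := Int.emod_eq_of_lt (by omega) (by omega)
      rw [← Int.modEq_iff_dvd, Int.ModEq, h3]
      omega
    by_cases hd : (4 * r : ℤ) ∣ w + 2 * a - m'
    · rw [if_pos hd, if_pos (hiff.1 hd)]
      obtain ⟨c, hc⟩ := hd
      rw [show (a : ℤ) * (a - 1) + (w + 2 * a) * (w' - 2 * a) =
        ((a : ℤ) * (a - 1) + m' * (w' - 2 * a)) + 4 * r * (c * (w' - 2 * a)) by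
          rw [show w + 2 * a = m' + 4 * r * c by linarith]; ring, qHalf_zpow_add_mul hr,
        mul_right_comm, mul_right_comm (1 / (4 * r : ℂ)), one_div_mul_cancel hr0, one_mul]
    · rw [if_neg hd, if_neg (fun h => hd (hiff.2 h)), mul_zero]
  rw [Finset.sum_congr rfl step, Finset.sum_ite_eq', if_pos]
  rw [Finset.mem_range]
  have hpos : (0 : ℤ) < 4 * r := by omega
  have h1 := Int.emod_nonneg (w + 2 * a) hpos.ne'
  have h2 := Int.emod_lt_of_pos (w + 2 * a) hpos
  omega

end Steinberg

noncomputable section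

namespace Steinberg

/-! ### The module `V_{r-1}` on its basis -/

theorem u_eq_single (r : ℕ) (m : Fin r) : u r m = Pi.basisFun ℂ (Fin r) m := by
  ext t
  simp [u, Pi.single_apply, Fin.ext_iff]

theorem u_eq_zero {r m : ℕ} (h : r ≤ m) : u r m = 0 := by
  ext t
  have := t.2
  simp only [u, Pi.zero_apply, ite_eq_right_iff]
  omega

theorem onBasis_u {r m : ℕ} (hm : m < r) (f : ℕ → V r) : onBasis r f (u r m) = f m := by
  have := u_eq_single r ⟨m, hm⟩
  dsimp only at this
  rw [this, onBasis, Module.Basis.constr_basis]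

theorem opE_u_zero (r : ℕ) : opE r (u r 0) = 0 := by
  rcases Nat.eq_zero_or_pos r with h | h
  · rw [u_eq_zero h.le, map_zero]
  · rw [opE, onBasis_u h, if_pos rfl]

theorem opE_u_succ {r m : ℕ} (hm : m + 1 < r) : opE r (u r (m + 1)) = u r m := by
  rw [opE, onBasis_u hm]
  simp

theorem opF_u {r : ℕ} (hr : 2 ≤ r) (m : ℕ) :
    opF r (u r m) = qInt r (m + 1) ^ 2 • u r (m + 1) := by
  rcases lt_or_ge m r with h | h
  · rw [opF, onBasis_u h, qInt_mul_qInt_sub hr]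
  · rw [u_eq_zero h, u_eq_zero (by omega : r ≤ m + 1), map_zero, smul_zero]

theorem opK_pow_u (r m t : ℕ) :
    (opK r ^ t) (u r m) = qHalf r ^ ((t : ℤ) * ((r : ℤ) - 1 - 2 * m)) • u r m := by
  rcases lt_or_ge m r with h | h
  · induction t with
    | zero => simp
    | succ t ih =>
      rw [pow_succ', Module.End.mul_apply, ih, map_smul, opK, onBasis_u h, smul_smul,
        ← zpow_add₀ (qHalf_ne_zero r)]
      congr 2
      push_cast
      ring
  · rw [u_eq_zero h, map_zero, smul_zero]

theorem opKInv_sq_u (r m : ℕ) :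
    (opKInv r ^ 2) (u r m) = qHalf r ^ (-2 * ((r : ℤ) - 1 - 2 * m)) • u r m := by
  rcases lt_or_ge m r with h | h
  · rw [pow_two, Module.End.mul_apply, opKInv, onBasis_u h, map_smul, onBasis_u h, smul_smul,
        ← zpow_add₀ (qHalf_ne_zero r)]
    congr 2
    ring
  · rw [u_eq_zero h, map_zero, smul_zero]

theorem opH_u (r m : ℕ) : opH r (u r m) = ((r : ℂ) - 1 - 2 * m) • u r m := by
  rcases lt_or_ge m r with h | h
  · rw [opH, onBasis_u h]
  · rw [u_eq_zero h, map_zero, smul_zero]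

theorem opE_pow_u {r m : ℕ} (hm : m < r) (a : ℕ) :
    (opE r ^ a) (u r m) = if a ≤ m then u r (m - a) else 0 := by
  induction a with
  | zero => simp
  | succ a ih =>
    rw [pow_succ', Module.End.mul_apply, ih]
    rcases lt_trichotomy a m with h | h | h
    · rw [if_pos h.le, if_pos (by omega : a + 1 ≤ m)]
      obtain ⟨t, ht⟩ : ∃ t, m - a = t + 1 := ⟨m - a - 1, by omega⟩
      rw [ht, opE_u_succ (by omega)]
      congr 1
      omega
    · rw [if_pos h.le, if_neg (by omega), h, Nat.sub_self, opE_u_zero]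
    · rw [if_neg (by omega), if_neg (by omega), map_zero]

theorem opF_pow_u {r : ℕ} (hr : 2 ≤ r) (m a : ℕ) :
    (opF r ^ a) (u r m) = (∏ i ∈ Finset.range a, qInt r (m + i + 1) ^ 2) • u r (m + a) := by
  induction a with
  | zero => simp
  | succ a ih =>
    rw [pow_succ', Module.End.mul_apply, ih, map_smul, opF_u hr, smul_smul,
      Finset.prod_range_succ]
    push_cast
    rfl

theorem opE_pow_self (r : ℕ) : opE r ^ r = 0 := by
  refine (Pi.basisFun ℂ (Fin r)).ext fun m => ?_
  rw [← u_eq_single, opE_pow_u m.2, if_neg (by omega), LinearMap.zero_apply]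

theorem opF_pow_u_eq_zero {r m a : ℕ} (hr : 2 ≤ r) (h : r ≤ m + a) :
    (opF r ^ a) (u r m) = 0 := by
  rw [opF_pow_u hr, u_eq_zero h, smul_zero]

theorem opK_sq_opE_pow_u {r m : ℕ} (hm : m < r) (a : ℕ) :
    (opK r ^ 2) ((opE r ^ a) (u r m)) =
      qHalf r ^ (2 * ((r : ℤ) - 1 - 2 * (m - a))) • (opE r ^ a) (u r m) := by
  rw [opE_pow_u hm]
  split_ifs with h
  · rw [opK_pow_u]
    congr 2
    push_cast [h]
    ring
  · simp

theorem opKInv_sq_opF_pow_u {r : ℕ} (hr : 2 ≤ r) (m a : ℕ) :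
    (opKInv r ^ 2) ((opF r ^ a) (u r m)) =
      qHalf r ^ (-2 * ((r : ℤ) - 1 - 2 * (m + a))) • (opF r ^ a) (u r m) := by
  rw [opF_pow_u hr, map_smul, opKInv_sq_u, smul_comm]
  push_cast
  rfl

/-! ### Splitting off the first tensor factor -/

/-- The bilinear map `V ⊗ V^{⊗ n} → V^{⊗ (n+1)}`. -/
def cons {n r : ℕ} : V r →ₗ[ℂ] TensorPow n r →ₗ[ℂ] TensorPow (n + 1) r :=
  (PiTensorProduct.lift (R := ℂ) (s := fun _ : Fin n => V r)).toLinearMap ∘ₗ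
    (PiTensorProduct.tprod ℂ (s := fun _ : Fin (n + 1) => V r)).curryLeft

theorem cons_tprod {n r : ℕ} (y : V r) (f : Fin n → V r) :
    cons y (PiTensorProduct.tprod ℂ f) =
      PiTensorProduct.tprod ℂ (Fin.cons y f : Fin (n + 1) → V r) := by
  simp [cons]

theorem hom_ext_cons {n r : ℕ} {M : Type*} [AddCommMonoid M] [Module ℂ M]
    {A B : TensorPow (n + 1) r →ₗ[ℂ] M}
    (h : ∀ m < r, ∀ x, A (cons (u r m) x) = B (cons (u r m) x)) : A = B := by
  have h' : ∀ y x, A (cons y x) = B (cons y x) := by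
    intro y x
    have : A ∘ₗ (cons.flip x) = B ∘ₗ (cons.flip x) := by
      refine (Pi.basisFun ℂ (Fin r)).ext fun m => ?_
      rw [← u_eq_single]
      exact h m m.2 x
    exact LinearMap.congr_fun this y
  refine PiTensorProduct.ext (MultilinearMap.ext fun f => ?_)
  have := h' (f 0) (PiTensorProduct.tprod ℂ (Fin.tail f))
  rw [cons_tprod] at this
  simpa using this

theorem hom_ext_cons_cons {n r : ℕ} {M : Type*} [AddCommMonoid M] [Module ℂ M]
    {A B : TensorPow (n + 2) r →ₗ[ℂ] M}
    (h : ∀ m < r, ∀ p < r, ∀ x,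
      A (cons (u r m) (cons (u r p) x)) = B (cons (u r m) (cons (u r p) x))) : A = B := by
  refine hom_ext_cons fun m hm x => ?_
  have : A ∘ₗ cons (u r m) = B ∘ₗ cons (u r m) := hom_ext_cons fun p hp x => h m hm p hp x
  exact LinearMap.congr_fun this x

theorem map_cons {n r : ℕ} (f : Fin (n + 1) → Module.End ℂ (V r)) (y : V r)
    (x : TensorPow n r) :
    PiTensorProduct.map f (cons y x) =
      cons (f 0 y) (PiTensorProduct.map (fun i => f i.succ) x) := by
  have : PiTensorProduct.map f ∘ₗ cons y =
      cons (f 0 y) ∘ₗ PiTensorProduct.map (fun i => f i.succ) := by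
    refine PiTensorProduct.ext (MultilinearMap.ext fun g => ?_)
    simp only [LinearMap.compMultilinearMap_apply, LinearMap.comp_apply, cons_tprod,
      PiTensorProduct.map_tprod]
    congr 1
    ext i
    refine Fin.cases ?_ (fun i => ?_) i <;> simp
  exact LinearMap.congr_fun this x

theorem sumInsert_cons {n r : ℕ} (a x b : Module.End ℂ (V r)) (y : V r) (v : TensorPow n r) :
    sumInsert (n + 1) r a x b (cons y v) =
      cons (x y) (PiTensorProduct.map (fun _ => b) v) + cons (a y) (sumInsert n r a x b v) := by
  simp only [sumInsert, Fin.sum_univ_succ, LinearMap.add_apply, LinearMap.sum_apply, map_sum]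
  refine congrArg₂ _ ?_ (Finset.sum_congr rfl fun i _ => ?_)
  · rw [map_cons]
    simp
  · rw [map_cons]
    simp

/-- The diagonal action of `k²` on `V^{⊗ n}`. -/
def tensorKSq (n r : ℕ) : Module.End ℂ (TensorPow n r) :=
  PiTensorProduct.map fun _ => opK r ^ 2

theorem tensorKSq_cons {n r : ℕ} (y : V r) (x : TensorPow n r) :
    tensorKSq (n + 1) r (cons y x) = cons ((opK r ^ 2) y) (tensorKSq n r x) := map_cons _ _ _

theorem tensorE_cons {n r : ℕ} (y : V r) (x : TensorPow n r) :
    tensorE (n + 1) r (cons y x) = cons (opE r y) (tensorKSq n r x) + cons y (tensorE n r x) :=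
  sumInsert_cons _ _ _ _ _

theorem tensorF_cons {n r : ℕ} (y : V r) (x : TensorPow n r) :
    tensorF (n + 1) r (cons y x) = cons (opF r y) x + cons ((opKInv r ^ 2) y) (tensorF n r x) := by
  have := sumInsert_cons (opKInv r ^ 2) (opF r) 1 y x
  rw [PiTensorProduct.map_one] at this
  exact this

theorem tensorH_cons {n r : ℕ} (y : V r) (x : TensorPow n r) :
    tensorH (n + 1) r (cons y x) = cons (opH r y) x + cons y (tensorH n r x) := by
  have := sumInsert_cons 1 (opH r) 1 y x
  rw [PiTensorProduct.map_one] at this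
  exact this

theorem sumInsert_zero_left (r : ℕ) (a x b : Module.End ℂ (V r)) : sumInsert 0 r a x b = 0 := by
  simp [sumInsert]

theorem tensorFlip_succ_cons {n r i : ℕ} (hi : i + 1 < n + 1) (y : V r)
    (x : TensorPow (n + 1) r) :
    tensorFlip (n := n + 2) r ⟨i + 1, hi⟩ (cons y x) =
      cons y (tensorFlip (n := n + 1) r ⟨i, Nat.lt_of_succ_lt_succ hi⟩ x) := by
  have : tensorFlip (n := n + 2) r ⟨i + 1, hi⟩ ∘ₗ cons y =
      cons y ∘ₗ tensorFlip (n := n + 1) r ⟨i, Nat.lt_of_succ_lt_succ hi⟩ := by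
    refine PiTensorProduct.ext (MultilinearMap.ext fun g => ?_)
    simp only [LinearMap.compMultilinearMap_apply, LinearMap.comp_apply, cons_tprod, tensorFlip,
      LinearEquiv.coe_coe, PiTensorProduct.reindex_tprod]
    congr 1
    have hs : ∀ k : Fin (n + 1), (Equiv.swap (leftPos (n := n + 2) ⟨i + 1, hi⟩)
        (rightPos ⟨i + 1, hi⟩)).symm k.succ =
        ((Equiv.swap (leftPos (n := n + 1) ⟨i, Nat.lt_of_succ_lt_succ hi⟩)
        (rightPos ⟨i, Nat.lt_of_succ_lt_succ hi⟩)).symm k).succ := by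
      intro k
      have := (Fin.succ_injective (n + 1)).swap_apply
        (leftPos (n := n + 1) ⟨i, Nat.lt_of_succ_lt_succ hi⟩)
        (rightPos ⟨i, Nat.lt_of_succ_lt_succ hi⟩) k
      rw [Equiv.symm_swap, Equiv.symm_swap, ← this]
      rfl
    have h0 : (Equiv.swap (leftPos (n := n + 2) ⟨i + 1, hi⟩)
        (rightPos ⟨i + 1, hi⟩)).symm 0 = 0 := by
      rw [Equiv.symm_swap]
      exact Equiv.swap_apply_of_ne_of_ne (by simp [leftPos, Fin.ext_iff])
        (by simp [rightPos, Fin.ext_iff])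
    ext k : 1
    refine Fin.cases ?_ (fun k => ?_) k
    · rw [h0]; rfl
    · rw [hs]; rfl
  exact LinearMap.congr_fun this x

theorem tensorFlip_zero_cons {n r : ℕ} (y z : V r) (x : TensorPow n r) :
    tensorFlip (n := n + 2) r ⟨0, Nat.succ_pos n⟩ (cons y (cons z x)) = cons z (cons y x) := by
  have : tensorFlip (n := n + 2) r ⟨0, Nat.succ_pos n⟩ ∘ₗ cons y ∘ₗ cons z =
      cons z ∘ₗ cons y := by
    refine PiTensorProduct.ext (MultilinearMap.ext fun g => ?_)
    simp only [LinearMap.compMultilinearMap_apply, LinearMap.comp_apply, cons_tprod, tensorFlip,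
      LinearEquiv.coe_coe, PiTensorProduct.reindex_tprod]
    congr 1
    ext k : 1
    rw [Equiv.symm_swap]
    have hl : leftPos (n := n + 2) ⟨0, Nat.succ_pos n⟩ = 0 := rfl
    have hr : rightPos (n := n + 2) ⟨0, Nat.succ_pos n⟩ = 1 := rfl
    rw [hl, hr]
    refine Fin.cases ?_ (fun k => Fin.cases ?_ (fun k => ?_) k) k
    · rw [Equiv.swap_apply_left]; rfl
    · rw [show (Fin.succ 0 : Fin (n + 2)) = 1 from rfl, Equiv.swap_apply_right]; rfl
    · rw [Equiv.swap_apply_of_ne_of_ne (Fin.succ_ne_zero _)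
        (by simp [Fin.ext_iff])]
      rfl
  exact LinearMap.congr_fun this x

theorem twoLegs_succ_cons {n r i : ℕ} (hi : i + 1 < n + 1) (a b : Module.End ℂ (V r)) (y : V r)
    (x : TensorPow (n + 1) r) :
    twoLegs (n := n + 2) r ⟨i + 1, hi⟩ a b (cons y x) =
      cons y (twoLegs (n := n + 1) r ⟨i, Nat.lt_of_succ_lt_succ hi⟩ a b x) := by
  rw [twoLegs, map_cons]
  simp [leftPos, rightPos, Fin.ext_iff, twoLegs]

theorem twoLegs_zero_cons {n r : ℕ} (a b : Module.End ℂ (V r)) (y z : V r) (x : TensorPow n r) :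
    twoLegs (n := n + 2) r ⟨0, Nat.succ_pos n⟩ a b (cons y (cons z x)) =
      cons (a y) (cons (b z) x) := by
  rw [twoLegs, map_cons, map_cons]
  simp [leftPos, rightPos, Fin.ext_iff]

theorem tensorR_succ_cons {n r i : ℕ} (hi : i + 1 < n + 1) (y : V r)
    (x : TensorPow (n + 1) r) :
    tensorR (n := n + 2) r ⟨i + 1, hi⟩ (cons y x) =
      cons y (tensorR (n := n + 1) r ⟨i, Nat.lt_of_succ_lt_succ hi⟩ x) := by
  simp only [tensorR, LinearMap.sum_apply, LinearMap.smul_apply, twoLegs_succ_cons, map_sum,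
    map_smul]

theorem sigmaOp_succ_cons {n r i : ℕ} (hi : i + 1 < n + 1) (y : V r)
    (x : TensorPow (n + 1) r) :
    sigmaOp (n + 2) r ⟨i + 1, hi⟩ (cons y x) =
      cons y (sigmaOp (n + 1) r ⟨i, Nat.lt_of_succ_lt_succ hi⟩ x) := by
  simp only [sigmaOp, LinearMap.smul_apply, Module.End.mul_apply, tensorR_succ_cons,
    tensorFlip_succ_cons, map_smul]

/-- The coefficients of `F^a ⊗ E^a` in the normalized braiding on `u_m ⊗ u_p`. -/
def braidCoeff (r : ℕ) (m p : ℤ) (a : ℕ) : ℂ :=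
  qNum r 1 ^ (2 * a) / qNumFactorial r a *
    qHalf r ^ ((a : ℤ) * (a - 1) - 2 * (r - 1) * (m + p) + 4 * (m - a) * (p + a))

/-- Powers of `k` act on `u_m` and `u_p` by scalars, so the sums over `m` and `m'` collapse by
`sum_coeffR`. The normalizing factor `q^{-(r-1)²/2}` cancels the constant term of the exponent, so
that `u_0 ⊗ u_0` is fixed. -/
theorem sigmaOp_zero_cons {n r m p : ℕ} (hr : 2 ≤ r) (x : TensorPow n r) :
    sigmaOp (n + 2) r ⟨0, Nat.succ_pos n⟩ (cons (u r m) (cons (u r p) x)) =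
      ∑ a ∈ Finset.range r, braidCoeff r m p a •
        cons ((opF r ^ a) (u r p)) (cons ((opE r ^ a) (u r m)) x) := by
  simp only [sigmaOp, LinearMap.smul_apply, Module.End.mul_apply, tensorR, LinearMap.sum_apply,
    twoLegs_zero_cons, opK_pow_u, map_smul, map_sum, tensorFlip_zero_cons, smul_smul,
    ← Finset.sum_smul, Finset.smul_sum]
  refine Finset.sum_congr rfl fun a _ => ?_
  have key := sum_coeffR hr a (r - 1 - 2 * m) (r - 1 - 2 * p)
  congr 1
  simp_rw [mul_comm (qHalf r ^ (_ * ((r : ℤ) - 1 - 2 * p)))]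
  rw [key, braidCoeff, mul_left_comm, ← zpow_add₀ (qHalf_ne_zero r)]
  congr 2
  ring

end Steinberg

end

noncomputable section

namespace Steinberg

/-! ### The weight decomposition -/

/-- The span of the vectors `u_{ε_1} ⊗ ⋯ ⊗ u_{ε_n}` with `ε_1 + ⋯ + ε_n = ℓ`. -/
def degreeSpace (n r : ℕ) (ℓ : ℤ) : Submodule ℂ (TensorPow n r) :=
  Submodule.span ℂ {v | ∃ ε : Fin n → Fin r, ∑ i, ((ε i : ℕ) : ℤ) = ℓ ∧
    v = PiTensorProduct.tprod ℂ fun i => u r (ε i)}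

theorem cons_mem_degreeSpace {n r m : ℕ} (hm : m < r) {ℓ : ℤ} {x : TensorPow n r}
    (hx : x ∈ degreeSpace n r ℓ) : cons (u r m) x ∈ degreeSpace (n + 1) r (m + ℓ) := by
  have : degreeSpace n r ℓ ≤ (degreeSpace (n + 1) r (m + ℓ)).comap (cons (u r m)) := by
    refine Submodule.span_le.2 ?_
    rintro _ ⟨ε, hε, rfl⟩
    refine Submodule.subset_span ⟨Fin.cons ⟨m, hm⟩ ε, ?_, ?_⟩
    · simp [Fin.sum_univ_succ, hε]
    · rw [cons_tprod]
      congr 1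
      ext i : 1
      refine Fin.cases ?_ (fun i => ?_) i <;> simp
  exact this hx

/-- The degree is an integer so that `ℓ - m` is never truncated; negative degrees simply give the
zero space. -/
theorem degreeSpace_succ_le {n r : ℕ} {ℓ : ℤ} {S : Submodule ℂ (TensorPow (n + 1) r)}
    (h : ∀ m < r, ∀ x ∈ degreeSpace n r (ℓ - m), cons (u r m) x ∈ S) :
    degreeSpace (n + 1) r ℓ ≤ S := by
  refine Submodule.span_le.2 ?_
  rintro _ ⟨ε, hε, rfl⟩
  have := h (ε 0) (ε 0).2 (PiTensorProduct.tprod ℂ fun i => u r (ε i.succ))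
    (Submodule.subset_span ⟨fun i => ε i.succ, by rw [Fin.sum_univ_succ] at hε; linarith, rfl⟩)
  rw [cons_tprod] at this
  rw [show (Fin.cons (u r (ε 0)) fun i => u r (ε i.succ) : Fin (n + 1) → V r) =
    fun i => u r (ε i) by ext i : 1; refine Fin.cases ?_ (fun i => ?_) i <;> simp] at this
  exact this

theorem degreeSpace_hom_ext {n r : ℕ} {M : Type*} [AddCommMonoid M] [Module ℂ M] {ℓ : ℤ}
    (A B : TensorPow (n + 1) r →ₗ[ℂ] M)
    (h : ∀ m < r, ∀ x ∈ degreeSpace n r (ℓ - m), A (cons (u r m) x) = B (cons (u r m) x))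
    {v : TensorPow (n + 1) r} (hv : v ∈ degreeSpace (n + 1) r ℓ) : A v = B v :=
  degreeSpace_succ_le (S := LinearMap.eqLocus A B) h hv

theorem hom_ext_degreeSpace {n r : ℕ} {M : Type*} [AddCommMonoid M] [Module ℂ M]
    {A B : TensorPow n r →ₗ[ℂ] M} (h : ∀ ℓ, ∀ x ∈ degreeSpace n r ℓ, A x = B x) : A = B := by
  induction n with
  | zero =>
    refine PiTensorProduct.ext (MultilinearMap.ext fun g => ?_)
    refine h 0 _ (Submodule.subset_span ⟨Fin.elim0, by simp, ?_⟩)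
    congr 1
    exact Subsingleton.elim _ _
  | succ n ih =>
    refine hom_ext_cons fun m hm x => ?_
    have : A ∘ₗ cons (u r m) = B ∘ₗ cons (u r m) :=
      ih fun ℓ x hx => h _ _ (cons_mem_degreeSpace hm hx)
    exact LinearMap.congr_fun this x

theorem eq_zero_of_mem_degreeSpace_zero {r : ℕ} {ℓ : ℤ} (hℓ : ℓ ≠ 0) {x : TensorPow 0 r}
    (hx : x ∈ degreeSpace 0 r ℓ) : x = 0 := by
  have : degreeSpace 0 r ℓ ≤ ⊥ := by
    refine Submodule.span_le.2 ?_
    rintro _ ⟨ε, hε, rfl⟩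
    exact absurd (by simpa using hε.symm) hℓ
  exact (Submodule.mem_bot ℂ).1 (this hx)

theorem tensorKSq_apply {n r : ℕ} {ℓ : ℤ} {x : TensorPow n r} (hx : x ∈ degreeSpace n r ℓ) :
    tensorKSq n r x = qHalf r ^ (2 * (n * ((r : ℤ) - 1) - 2 * ℓ)) • x := by
  induction n generalizing ℓ with
  | zero =>
    by_cases hℓ : ℓ = 0
    · subst hℓ
      simp only [tensorKSq]
      rw [show (fun _ : Fin 0 => opK r ^ 2) = fun _ => 1 from Subsingleton.elim _ _,
        PiTensorProduct.map_one]
      simp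
    · rw [eq_zero_of_mem_degreeSpace_zero hℓ hx, map_zero, smul_zero]
  | succ n ih =>
    refine degreeSpace_hom_ext (tensorKSq (n + 1) r)
      (qHalf r ^ (2 * (((n + 1 : ℕ) : ℤ) * ((r : ℤ) - 1) - 2 * ℓ)) • LinearMap.id)
      (fun m hm x hx => ?_) hx
    rw [tensorKSq_cons, ih hx, opK_pow_u, LinearMap.smul_apply, LinearMap.id_apply, map_smul,
      map_smul, LinearMap.smul_apply, smul_smul, ← zpow_add₀ (qHalf_ne_zero r)]
    congr 2
    push_cast
    ring

theorem tensorH_apply {n r : ℕ} {ℓ : ℤ} {x : TensorPow n r} (hx : x ∈ degreeSpace n r ℓ) :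
    tensorH n r x = ((n : ℂ) * ((r : ℂ) - 1) - 2 * ℓ) • x := by
  induction n generalizing ℓ with
  | zero =>
    by_cases hℓ : ℓ = 0
    · subst hℓ
      simp [tensorH, sumInsert_zero_left]
    · rw [eq_zero_of_mem_degreeSpace_zero hℓ hx, map_zero, smul_zero]
  | succ n ih =>
    refine degreeSpace_hom_ext (tensorH (n + 1) r)
      ((((n + 1 : ℕ) : ℂ) * ((r : ℂ) - 1) - 2 * ℓ) • LinearMap.id) (fun m hm x hx => ?_) hx
    rw [tensorH_cons, ih hx, opH_u, LinearMap.smul_apply, LinearMap.id_apply, map_smul,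
      map_smul, LinearMap.smul_apply, ← add_smul]
    congr 1
    push_cast
    ring

/-- The pure tensors of basis vectors diagonalize `H`, and their eigenvalues separate the degrees
because the ground field has characteristic zero. -/
theorem weightSpace_eq_degreeSpace (n r ℓ : ℕ) : weightSpace n r ℓ = degreeSpace n r ℓ := by
  apply le_antisymm
  · intro v hv
    rw [weightSpace, LinearMap.mem_ker] at hv
    let b := Basis.piTensorProduct fun _ : Fin n => Pi.basisFun ℂ (Fin r)
    have hb : ∀ ε : Fin n → Fin r, b ε ∈ degreeSpace n r (∑ i, ((ε i : ℕ) : ℤ)) := by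
      intro ε
      refine Submodule.subset_span ⟨ε, rfl, ?_⟩
      simp only [b, Basis.piTensorProduct_apply, u_eq_single]
    rw [← b.sum_repr v] at hv ⊢
    simp only [map_sum, map_smul, LinearMap.sub_apply, LinearMap.smul_apply,
      Module.End.one_apply] at hv
    have hv' : ∑ ε, (b.repr v ε * (2 * (ℓ - ((∑ i, ((ε i : ℕ) : ℤ) : ℤ) : ℂ)))) • b ε = 0 := by
      rw [← hv]
      refine Finset.sum_congr rfl fun ε _ => ?_
      rw [tensorH_apply (hb ε)]
      module
    have hz := Fintype.linearIndependent_iff.1 b.linearIndependent _ hv'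
    refine Submodule.sum_mem _ fun ε _ => ?_
    by_cases hε : ∑ i, ((ε i : ℕ) : ℤ) = ℓ
    · exact Submodule.smul_mem _ _ (hε ▸ hb ε)
    · have h1 : (ℓ - ((∑ i, ((ε i : ℕ) : ℤ) : ℤ) : ℂ)) ≠ 0 := by
        rw [sub_ne_zero]
        intro h
        exact hε (by exact_mod_cast h.symm)
      have h2 := hz ε
      simp only [mul_eq_zero, h1, OfNat.ofNat_ne_zero, or_false] at h2
      rw [h2, zero_smul]
      exact Submodule.zero_mem _
  · intro v hv
    rw [weightSpace, LinearMap.mem_ker, LinearMap.sub_apply, tensorH_apply hv]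
    simp

theorem tensorE_mem {n r : ℕ} {ℓ : ℤ} {x : TensorPow n r} (hx : x ∈ degreeSpace n r ℓ) :
    tensorE n r x ∈ degreeSpace n r (ℓ - 1) := by
  induction n generalizing ℓ with
  | zero =>
    rw [tensorE, sumInsert_zero_left]
    exact Submodule.zero_mem _
  | succ n ih =>
    refine degreeSpace_succ_le (S := (degreeSpace (n + 1) r (ℓ - 1)).comap (tensorE (n + 1) r))
      (fun m hm x hx => ?_) hx
    rw [Submodule.mem_comap, tensorE_cons, tensorKSq_apply hx, map_smul]
    refine Submodule.add_mem _ (Submodule.smul_mem _ _ ?_) ?_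
    · cases m with
      | zero =>
        rw [opE_u_zero, map_zero]
        exact Submodule.zero_mem _
      | succ m =>
        rw [opE_u_succ hm]
        have := cons_mem_degreeSpace (by omega : m < r) hx
        rwa [show (m : ℤ) + (ℓ - (m + 1 : ℕ)) = ℓ - 1 by push_cast; ring] at this
    · have := cons_mem_degreeSpace hm (ih hx)
      rwa [show (m : ℤ) + (ℓ - m - 1) = ℓ - 1 by ring] at this

theorem tensorF_mem {n r : ℕ} (hr : 2 ≤ r) {ℓ : ℤ} {x : TensorPow n r}
    (hx : x ∈ degreeSpace n r ℓ) : tensorF n r x ∈ degreeSpace n r (ℓ + 1) := by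
  induction n generalizing ℓ with
  | zero =>
    rw [tensorF, sumInsert_zero_left]
    exact Submodule.zero_mem _
  | succ n ih =>
    refine degreeSpace_succ_le (S := (degreeSpace (n + 1) r (ℓ + 1)).comap (tensorF (n + 1) r))
      (fun m hm x hx => ?_) hx
    rw [Submodule.mem_comap, tensorF_cons, opF_u hr, opKInv_sq_u, map_smul, map_smul]
    refine Submodule.add_mem _ (Submodule.smul_mem _ _ ?_) (Submodule.smul_mem _ _ ?_)
    · rcases lt_or_ge (m + 1) r with h | h
      · have := cons_mem_degreeSpace h hx
        rwa [show ((m + 1 : ℕ) : ℤ) + (ℓ - m) = ℓ + 1 by push_cast; ring] at this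
      · rw [u_eq_zero h, map_zero]
        exact Submodule.zero_mem _
    · have := cons_mem_degreeSpace hm (ih hx)
      rwa [show (m : ℤ) + (ℓ - m + 1) = ℓ + 1 by ring] at this

theorem tensorE_pow_mem {n r : ℕ} {ℓ : ℤ} {x : TensorPow n r} (hx : x ∈ degreeSpace n r ℓ)
    (a : ℕ) : (tensorE n r ^ a) x ∈ degreeSpace n r (ℓ - a) := by
  induction a with
  | zero => simpa using hx
  | succ a ih =>
    rw [pow_succ', Module.End.mul_apply]
    have := tensorE_mem ih
    rwa [show ℓ - (a : ℤ) - 1 = ℓ - (a + 1 : ℕ) by push_cast; ring] at this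

/-! ### Commutation relations -/

/-- Linearizing products of quantum numbers reduces quadratic identities among them to comparisons
of exponents. -/
theorem qNum_mul_qNum (r : ℕ) (x y : ℤ) :
    qNum r x * qNum r y = (qHalf r ^ (2 * (x + y)) + qHalf r ^ (-(2 * (x + y)))) -
      (qHalf r ^ (2 * (x - y)) + qHalf r ^ (-(2 * (x - y)))) := by
  have h0 := qHalf_ne_zero r
  rw [qNum_eq, qNum_eq, sub_mul, mul_sub, mul_sub, ← zpow_add₀ h0, ← zpow_add₀ h0,
    ← zpow_add₀ h0, ← zpow_add₀ h0]
  ring_nf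

/-- The induction step that sums the commutators `[E, F]` picked up when `F` passes through a power
of `E`, or `E` through a power of `F`. -/
theorem qInt_mul_qInt_add_qInt {r : ℕ} (hr : 2 ≤ r) (a y : ℤ) :
    qInt r (y + 2 * a) + qInt r a * qInt r (y + a - 1) = qInt r (a + 1) * qInt r (y + a) := by
  have h1 := qNum_one_ne_zero hr
  have key : qNum r (y + 2 * a) * qNum r 1 + qNum r a * qNum r (y + a - 1) =
      qNum r (a + 1) * qNum r (y + a) := by
    simp only [qNum_mul_qNum]
    ring_nf
  simp only [qInt]
  field_simp
  linear_combination key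

/-- Comes down to `[m+1]² - [m]² = [2m+1] = [r-1-2m]`. -/
theorem opE_opF_u {r m : ℕ} (hr : 2 ≤ r) (hm : m < r) :
    opE r (opF r (u r m)) = opF r (opE r (u r m)) + qInt r ((r : ℤ) - 1 - 2 * m) • u r m := by
  have hEF : opE r (opF r (u r m)) = qInt r (m + 1) ^ 2 • u r m := by
    rw [opF_u hr, map_smul]
    rcases lt_or_ge (m + 1) r with h | h
    · rw [opE_u_succ h]
    · obtain rfl : r = m + 1 := by omega
      -- At the top vector `u_{r-1}` both sides vanish, the right one because `[r] = 0`.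
      rw [(qInt_eq_zero_iff hr _).2 (by push_cast; simp)]
      simp
  have hFE : opF r (opE r (u r m)) = qInt r m ^ 2 • u r m := by
    cases m with
    | zero => simp [opE_u_zero, qInt, qNum]
    | succ m => rw [opE_u_succ hm, opF_u hr]; push_cast; rfl
  rw [hEF, hFE, ← add_smul]
  congr 1
  have h1 := qNum_one_ne_zero hr
  have h2 := qNum_sub_left hr (1 + 2 * m)
  rw [qInt, qInt, qInt, show (r : ℤ) - 1 - 2 * m = r - (1 + 2 * m) by ring, h2]
  field_simp
  simp only [pow_two, qNum_mul_qNum]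
  ring_nf

/-- Induction through the coproduct: the mixed terms cancel by `h1`, and the two diagonal
commutators add up to one quantum integer by `h2`. -/
theorem tensorE_tensorF {n r : ℕ} (hr : 2 ≤ r) {ℓ : ℤ} {x : TensorPow n r}
    (hx : x ∈ degreeSpace n r ℓ) : tensorE n r (tensorF n r x) =
      tensorF n r (tensorE n r x) + qInt r (n * ((r : ℤ) - 1) - 2 * ℓ) • x := by
  have h0 := qHalf_ne_zero r
  induction n generalizing ℓ with
  | zero =>
    by_cases hℓ : ℓ = 0
    · subst hℓ
      simp [tensorE, tensorF, sumInsert_zero_left, qInt, qNum]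
    · rw [eq_zero_of_mem_degreeSpace_zero hℓ hx]
      simp
  | succ n ih =>
    refine degreeSpace_hom_ext (tensorE (n + 1) r * tensorF (n + 1) r)
      (tensorF (n + 1) r * tensorE (n + 1) r +
        qInt r ((n + 1 : ℕ) * ((r : ℤ) - 1) - 2 * ℓ) • LinearMap.id) (fun m hm x hx => ?_) hx
    have hKE : (opKInv r ^ 2) (opE r (u r m)) =
        qHalf r ^ (-2 * ((r : ℤ) - 1 - 2 * (m - 1))) • opE r (u r m) := by
      cases m with
      | zero => simp [opE_u_zero]
      | succ m => rw [opE_u_succ hm, opKInv_sq_u]; push_cast; congr 2; ring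
    simp only [Module.End.mul_apply, LinearMap.add_apply, LinearMap.smul_apply,
      LinearMap.id_apply, tensorF_cons, tensorE_cons, map_add, map_smul, ih hx, hKE,
      tensorKSq_apply hx, tensorKSq_apply (tensorF_mem hr hx), opE_opF_u hr hm, opKInv_sq_u,
      smul_add, smul_smul, ← zpow_add₀ h0]
    have h1 : -2 * ((r : ℤ) - 1 - 2 * m) + 2 * (n * ((r : ℤ) - 1) - 2 * (ℓ - m + 1)) =
      2 * (n * ((r : ℤ) - 1) - 2 * (ℓ - m)) + -2 * ((r : ℤ) - 1 - 2 * (m - 1)) := by ring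
    have h2 : qInt r ((n + 1 : ℕ) * ((r : ℤ) - 1) - 2 * ℓ) =
        qHalf r ^ (2 * (n * ((r : ℤ) - 1) - 2 * (ℓ - m))) * qInt r ((r : ℤ) - 1 - 2 * m) +
        qHalf r ^ (-2 * ((r : ℤ) - 1 - 2 * m)) * qInt r (n * ((r : ℤ) - 1) - 2 * (ℓ - m)) := by
      simp only [qInt, mul_div_assoc', ← add_div, qNum_eq, mul_sub, ← zpow_add₀ h0]
      push_cast
      ring_nf
    rw [h1, h2]
    module

theorem tensorE_pow_tensorF {n r : ℕ} (hr : 2 ≤ r) {ℓ : ℤ} {x : TensorPow n r}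
    (hx : x ∈ degreeSpace n r ℓ) (a : ℕ) : (tensorE n r ^ (a + 1)) (tensorF n r x) =
      tensorF n r ((tensorE n r ^ (a + 1)) x) +
        (qInt r (a + 1) * qInt r (n * ((r : ℤ) - 1) - 2 * ℓ + a)) • (tensorE n r ^ a) x := by
  induction a with
  | zero =>
    have h1 : qInt r 1 = 1 := div_self (qNum_one_ne_zero hr)
    simp [tensorE_tensorF hr hx, h1]
  | succ a ih =>
    rw [pow_succ', Module.End.mul_apply, ih, map_add, map_smul,
      tensorE_tensorF hr (tensorE_pow_mem hx (a + 1)), Module.End.mul_apply,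
      ← Module.End.mul_apply _ (tensorE n r ^ a), ← pow_succ' _ a]
    have := qInt_mul_qInt_add_qInt hr (a + 1) (n * ((r : ℤ) - 1) - 2 * ℓ)
    push_cast
    rw [← this, show (n * ((r : ℤ) - 1) - 2 * (ℓ - (a + 1 : ℤ))) =
        n * ((r : ℤ) - 1) - 2 * ℓ + 2 * (a + 1) by ring,
      show n * ((r : ℤ) - 1) - 2 * ℓ + (a + 1) - 1 = n * ((r : ℤ) - 1) - 2 * ℓ + a by ring]
    module

/-! ### The `q`-binomial formula -/

/-- Gaussian binomial coefficients, `gauss r a b = q^{ab} {a+b}! / ({a}! {b}!)`. -/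
def gauss (r : ℕ) : ℕ → ℕ → ℂ
  | 0, _ => 1
  | _ + 1, 0 => 1
  | a + 1, b + 1 => qHalf r ^ (4 * ((b : ℤ) + 1)) * gauss r a (b + 1) + gauss r (a + 1) b

theorem gauss_zero_right (r a : ℕ) : gauss r a 0 = 1 := by
  cases a <;> simp [gauss]

/-- Stated without division because `{a}!` vanishes for `a ≥ r`; the Pascal-type recursion defining
`gauss` makes sense for all indices. -/
theorem gauss_mul_qNumFactorial (r a b : ℕ) :
    gauss r a b * (qNumFactorial r a * qNumFactorial r b) =
      qHalf r ^ (2 * (a : ℤ) * b) * qNumFactorial r (a + b) := by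
  have h0 := qHalf_ne_zero r
  induction a generalizing b with
  | zero => simp [gauss, qNumFactorial_zero]
  | succ a iha =>
    induction b with
    | zero => simp [gauss, qNumFactorial_zero]
    | succ b ihb =>
      have h1 := iha (b + 1)
      rw [gauss, show a + 1 + (b + 1) = a + b + 1 + 1 by ring, qNumFactorial_succ r (a + b + 1),
        qNumFactorial_succ r a, qNumFactorial_succ r b]
      rw [qNumFactorial_succ r b, show a + (b + 1) = a + b + 1 by ring] at h1
      rw [qNumFactorial_succ r a, show a + 1 + b = a + b + 1 by ring] at ihb
      have h3 : qHalf r ^ (4 * ((b : ℤ) + 1)) * qHalf r ^ (2 * (a : ℤ) * (b + 1 : ℕ)) *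
          qNum r (a + 1) + qHalf r ^ (2 * ((a + 1 : ℕ) : ℤ) * b) * qNum r (b + 1) =
          qHalf r ^ (2 * ((a + 1 : ℕ) : ℤ) * (b + 1 : ℕ)) * qNum r ((a + b + 1 : ℕ) + 1) := by
        simp only [qNum_eq, mul_sub, ← zpow_add₀ h0]
        push_cast
        ring_nf
      linear_combination (qHalf r ^ (4 * ((b : ℤ) + 1)) * qNum r (a + 1)) * h1 +
        qNum r (b + 1) * ihb + qNumFactorial r (a + b + 1) * h3

theorem gauss_eq {r a b : ℕ} (hr : 2 ≤ r) (h : a + b < r) :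
    gauss r a b = qHalf r ^ (2 * (a : ℤ) * b) * qNumFactorial r (a + b) /
      (qNumFactorial r a * qNumFactorial r b) := by
  rw [eq_div_iff (mul_ne_zero (qNumFactorial_ne_zero hr (by omega))
    (qNumFactorial_ne_zero hr (by omega))), gauss_mul_qNumFactorial]

/-- The numerator contains `{r} = 0` while the denominator does not vanish. This makes the `r`-th
powers of `E` and `F` on tensor powers zero. -/
theorem gauss_eq_zero {r a b : ℕ} (hr : 2 ≤ r) (h : a + b = r) (ha : a ≠ 0) (hb : b ≠ 0) :
    gauss r a b = 0 := by
  have h1 := gauss_mul_qNumFactorial r a b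
  rw [h, qNumFactorial_self hr, mul_zero] at h1
  exact (mul_eq_zero.1 h1).resolve_right (mul_ne_zero (qNumFactorial_ne_zero hr (by omega))
    (qNumFactorial_ne_zero hr (by omega)))

/-- The `q`-binomial theorem for `T = X + Y` with `X` and `Y` commuting up to a power of `q`,
phrased through the vectors `v a b` playing the role of `X^a Y^b` applied to a fixed vector. It
serves for both `E` and `F`. -/
theorem pow_apply_eq_sum_gauss {M : Type*} [AddCommGroup M] [Module ℂ M] {r : ℕ}
    (T : Module.End ℂ M) (v : ℕ → ℕ → M)
    (hv : ∀ a b, T (v a b) = qHalf r ^ (4 * (b : ℤ)) • v (a + 1) b + v a (b + 1)) (c : ℕ) :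
    (T ^ c) (v 0 0) = ∑ p ∈ Finset.HasAntidiagonal.antidiagonal c, gauss r p.1 p.2 • v p.1 p.2 := by
  induction c with
  | zero => simp [gauss]
  | succ c ih =>
    rw [pow_succ', Module.End.mul_apply, ih, map_sum]
    simp only [map_smul, hv, smul_add, Finset.sum_add_distrib, smul_smul]
    cases c with
    | zero =>
      simp [Finset.Nat.antidiagonal_succ, gauss]
      abel
    -- Both boundary terms of the antidiagonals are split off so that the recursion for `gauss`
    -- applies to the interior ones.
    | succ c =>
      rw [Finset.Nat.sum_antidiagonal_succ' (n := c), Finset.Nat.sum_antidiagonal_succ (n := c),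
        Finset.Nat.sum_antidiagonal_succ' (n := c + 1), Finset.Nat.sum_antidiagonal_succ (n := c)]
      simp only [gauss, gauss_zero_right, add_smul, Finset.sum_add_distrib, Nat.cast_zero, mul_zero,
        zpow_zero, mul_one, one_smul, Nat.cast_add, Nat.cast_one]
      simp only [mul_comm (gauss r _ _)]
      abel

end Steinberg

end

noncomputable section

namespace Steinberg

/-! ### Powers of `E` and `F` -/

theorem tensorE_pow_cons {n r : ℕ} {ℓ : ℤ} (y : V r) {x : TensorPow n r}
    (hx : x ∈ degreeSpace n r ℓ) (c : ℕ) :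
    (tensorE (n + 1) r ^ c) (cons y x) = ∑ p ∈ Finset.HasAntidiagonal.antidiagonal c,
      gauss r p.1 p.2 • qHalf r ^ (2 * (p.1 : ℤ) * (n * ((r : ℤ) - 1) - 2 * ℓ)) •
        cons ((opE r ^ p.1) y) ((tensorE n r ^ p.2) x) := by
  have := pow_apply_eq_sum_gauss (r := r) (tensorE (n + 1) r)
    (fun a b => qHalf r ^ (2 * (a : ℤ) * (n * ((r : ℤ) - 1) - 2 * ℓ)) •
      cons ((opE r ^ a) y) ((tensorE n r ^ b) x)) ?_ c
  · simpa using this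
  · intro a b
    rw [map_smul, tensorE_cons, tensorKSq_apply (tensorE_pow_mem hx b), map_smul, smul_add,
      smul_smul, smul_smul, ← zpow_add₀ (qHalf_ne_zero r), ← zpow_add₀ (qHalf_ne_zero r),
      pow_succ', pow_succ', Module.End.mul_apply, Module.End.mul_apply]
    congr 3
    push_cast
    ring

theorem tensorF_pow_cons {n r : ℕ} (hr : 2 ≤ r) (m : ℕ) (x : TensorPow n r) (c : ℕ) :
    (tensorF (n + 1) r ^ c) (cons (u r m) x) = ∑ p ∈ Finset.HasAntidiagonal.antidiagonal c,
      gauss r p.1 p.2 • qHalf r ^ (-2 * (p.1 : ℤ) * ((r : ℤ) - 1 - 2 * m)) •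
        cons ((opF r ^ p.2) (u r m)) ((tensorF n r ^ p.1) x) := by
  have := pow_apply_eq_sum_gauss (r := r) (tensorF (n + 1) r)
    (fun a b => qHalf r ^ (-2 * (a : ℤ) * ((r : ℤ) - 1 - 2 * m)) •
      cons ((opF r ^ b) (u r m)) ((tensorF n r ^ a) x)) ?_ c
  · simpa using this
  · intro a b
    rw [map_smul, tensorF_cons, opKInv_sq_opF_pow_u hr, map_smul, LinearMap.smul_apply, smul_add,
      smul_smul, smul_smul, ← zpow_add₀ (qHalf_ne_zero r), ← zpow_add₀ (qHalf_ne_zero r),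
      pow_succ', pow_succ', Module.End.mul_apply, Module.End.mul_apply,
      add_comm (_ • cons (opF r _) _)]
    congr 3
    push_cast
    ring

/-- In the `q`-binomial expansion the mixed terms have zero coefficient, and the two extreme terms
contain an `r`-th power of `E` on fewer factors. -/
theorem tensorE_pow_self {n r : ℕ} (hr : 2 ≤ r) : tensorE n r ^ r = 0 := by
  induction n with
  | zero => rw [tensorE, sumInsert_zero_left, zero_pow (by omega)]
  | succ n ih =>
    refine hom_ext_cons fun m hm x => ?_
    have : (tensorE (n + 1) r ^ r) ∘ₗ cons (u r m) = 0 := by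
      refine hom_ext_degreeSpace fun ℓ x hx => ?_
      rw [LinearMap.comp_apply, tensorE_pow_cons _ hx]
      refine Finset.sum_eq_zero fun p hp => ?_
      rw [Finset.HasAntidiagonal.mem_antidiagonal] at hp
      by_cases h1 : p.1 = 0
      · rw [show p.2 = r by omega, ih]
        simp
      by_cases h2 : p.2 = 0
      · rw [show p.1 = r by omega, opE_pow_self]
        simp
      · rw [gauss_eq_zero hr hp h1 h2, zero_smul]
    exact LinearMap.congr_fun this x

theorem tensorF_pow_self {n r : ℕ} (hr : 2 ≤ r) : tensorF n r ^ r = 0 := by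
  induction n with
  | zero => rw [tensorF, sumInsert_zero_left, zero_pow (by omega)]
  | succ n ih =>
    refine hom_ext_cons fun m hm x => ?_
    rw [tensorF_pow_cons hr]
    refine Finset.sum_eq_zero fun p hp => ?_
    rw [Finset.HasAntidiagonal.mem_antidiagonal] at hp
    by_cases h1 : p.1 = 0
    · rw [show p.2 = r by omega, opF_pow_u_eq_zero hr (by omega)]
      simp
    by_cases h2 : p.2 = 0
    · rw [show p.1 = r by omega, ih]
      simp
    · rw [gauss_eq_zero hr hp h1 h2, zero_smul]

theorem qInt_neg (r : ℕ) (x : ℤ) : qInt r (-x) = -qInt r x := by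
  simp only [qInt, qNum, neg_neg]
  ring

theorem opE_pow_opF_u {r m : ℕ} (hr : 2 ≤ r) (hm : m < r) (a : ℕ) :
    (opE r ^ (a + 1)) (opF r (u r m)) = opF r ((opE r ^ (a + 1)) (u r m)) +
      (qInt r (a + 1) * qInt r ((r : ℤ) - 1 - 2 * m + a)) • (opE r ^ a) (u r m) := by
  have hw : ∀ b : ℕ, opE r (opF r ((opE r ^ b) (u r m))) = opF r (opE r ((opE r ^ b) (u r m))) +
      qInt r ((r : ℤ) - 1 - 2 * (m - b)) • (opE r ^ b) (u r m) := by
    intro b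
    rw [opE_pow_u hm]
    split_ifs with h
    · rw [opE_opF_u hr (by omega)]
      push_cast [h]
      rfl
    · simp
  induction a with
  | zero =>
    have h1 : qInt r 1 = 1 := div_self (qNum_one_ne_zero hr)
    simp [opE_opF_u hr hm, h1]
  | succ a ih =>
    rw [pow_succ', Module.End.mul_apply, ih, map_add, map_smul, hw, Module.End.mul_apply,
      ← Module.End.mul_apply _ (opE r ^ a), ← pow_succ' _ a]
    have := qInt_mul_qInt_add_qInt hr (a + 1) ((r : ℤ) - 1 - 2 * m)
    push_cast
    rw [← this, show (r : ℤ) - 1 - 2 * (m - (a + 1 : ℤ)) = (r : ℤ) - 1 - 2 * m + 2 * (a + 1) by ring,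
      show (r : ℤ) - 1 - 2 * m + (a + 1) - 1 = (r : ℤ) - 1 - 2 * m + a by ring]
    module

theorem opE_opF_pow_u {r p : ℕ} (hr : 2 ≤ r) (hp : p < r) (a : ℕ) :
    opE r ((opF r ^ (a + 1)) (u r p)) = (opF r ^ (a + 1)) (opE r (u r p)) +
      (qInt r (a + 1) * qInt r ((r : ℤ) - 1 - 2 * p - a)) • (opF r ^ a) (u r p) := by
  have hw : ∀ b : ℕ, opE r (opF r ((opF r ^ b) (u r p))) = opF r (opE r ((opF r ^ b) (u r p))) +
      qInt r ((r : ℤ) - 1 - 2 * (p + b)) • (opF r ^ b) (u r p) := by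
    intro b
    rcases lt_or_ge (p + b) r with h | h
    · rw [opF_pow_u hr, map_smul, map_smul, opE_opF_u hr h, map_smul, map_smul]
      push_cast
      module
    · rw [opF_pow_u_eq_zero hr h]
      simp
  induction a with
  | zero =>
    have h1 : qInt r 1 = 1 := div_self (qNum_one_ne_zero hr)
    simp [opE_opF_u hr hp, h1]
  | succ a ih =>
    rw [pow_succ', Module.End.mul_apply, hw, ih, map_add, map_smul, Module.End.mul_apply,
      ← Module.End.mul_apply _ (opF r ^ a), ← pow_succ' _ a]
    -- Lowering past powers of `F` moves the weight in the opposite direction, so the identity is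
    -- used at the negated weight and the signs are removed with `qInt_neg`.
    have := qInt_mul_qInt_add_qInt hr (a + 1) (-((r : ℤ) - 1 - 2 * p))
    rw [show -((r : ℤ) - 1 - 2 * p) + 2 * (a + 1) = -((r : ℤ) - 1 - 2 * (p + (a + 1))) by ring,
      show -((r : ℤ) - 1 - 2 * p) + (a + 1) - 1 = -((r : ℤ) - 1 - 2 * p - a) by ring,
      show -((r : ℤ) - 1 - 2 * p) + (a + 1) = -((r : ℤ) - 1 - 2 * p - (a + 1)) by ring,
      qInt_neg, qInt_neg, qInt_neg] at this
    push_cast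
    rw [show qInt r ((a : ℤ) + 1 + 1) * qInt r ((r : ℤ) - 1 - 2 * p - (a + 1)) =
      qInt r ((r : ℤ) - 1 - 2 * (p + (a + 1))) + qInt r (a + 1) * qInt r ((r : ℤ) - 1 - 2 * p - a)
      by linear_combination this]
    module

/-! ### The braiding is equivariant -/

theorem braidCoeff_succ {r : ℕ} (hr : 2 ≤ r) {a : ℕ} (ha : a + 1 < r) (m p y : ℤ) :
    braidCoeff r m p (a + 1) * (qInt r (a + 1) * qInt r y) =
      qNum r 1 ^ (2 * a) / qNumFactorial r a * qHalf r ^ (((a : ℤ) + 1) * a -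
        2 * (r - 1) * (m + p) + 4 * (m - a - 1) * (p + a + 1)) * qNum r y := by
  have h1 := qNum_one_ne_zero hr
  have h2 : qNum r (a + 1) ≠ 0 := qNum_ne_zero hr (by omega) (by omega)
  have h3 := qNumFactorial_ne_zero hr (by omega : a < r)
  rw [braidCoeff, qNumFactorial_succ, qInt, qInt]
  rw [show ((a + 1 : ℕ) : ℤ) * ((a + 1 : ℕ) - 1) - 2 * (r - 1) * (m + p) +
    4 * (m - (a + 1 : ℕ)) * (p + (a + 1 : ℕ)) = ((a : ℤ) + 1) * a -
        2 * (r - 1) * (m + p) + 4 * (m - a - 1) * (p + a + 1) by push_cast; ring]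
  field_simp
  ring

/-- The scalar content of `E`-equivariance: it compares the coefficients of `F^a u_p ⊗ E^{a+1} u_m`
on the two sides of `sum_braid_opE`. -/
theorem braidCoeff_opE_rec {r : ℕ} (hr : 2 ≤ r) {a : ℕ} (ha : a + 1 < r) (m p : ℤ) :
    qHalf r ^ (2 * ((r : ℤ) - 1 - 2 * p)) * braidCoeff r (m - 1) p a =
      braidCoeff r m p (a + 1) * (qInt r (a + 1) * qInt r ((r : ℤ) - 1 - 2 * p - a)) *
        qHalf r ^ (2 * ((r : ℤ) - 1 - 2 * (m - (a + 1 : ℕ)))) + braidCoeff r m p a := by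
  have h0 := qHalf_ne_zero r
  rw [braidCoeff_succ hr ha, braidCoeff, braidCoeff, mul_left_comm, mul_assoc (_ / _ * _),
    mul_assoc (_ / _), ← mul_add, qNum_eq r (_ - _), sub_mul]
  simp only [mul_sub, ← zpow_add₀ h0]
  push_cast
  ring_nf

/-- The analogue for `F`, comparing coefficients of `F^{a+1} u_p ⊗ E^a u_m`. -/
theorem braidCoeff_opF_rec {r : ℕ} (hr : 2 ≤ r) {a : ℕ} (ha : a + 1 < r) (m p : ℤ) :
    braidCoeff r (m + 1) p (a + 1) * (qInt r (a + 1) * qInt r ((r : ℤ) - 1 - 2 * m + a)) +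
      qHalf r ^ (-2 * ((r : ℤ) - 1 - 2 * m)) * braidCoeff r m (p + 1) a = braidCoeff r m p a := by
  have h0 := qHalf_ne_zero r
  rw [braidCoeff_succ hr ha, braidCoeff, braidCoeff, mul_left_comm (qHalf r ^ _),
    mul_assoc (_ / _), ← mul_add, qNum_eq r (_ + _), mul_sub]
  simp only [← zpow_add₀ h0]
  ring_nf

/-- The left side is the braiding after the coproduct of `E`, the right side the coproduct of `E`
after the braiding. The bilinear map `B` absorbs the remaining tensor factors. The integer index `m
- 1` is harmless for `m = 0`, where `E u_0 = 0`. -/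
theorem sum_braid_opE {r m p : ℕ} {M : Type*} [AddCommGroup M] [Module ℂ M] (hr : 2 ≤ r)
    (hm : m < r) (hp : p < r) (B : V r →ₗ[ℂ] V r →ₗ[ℂ] M) :
    qHalf r ^ (2 * ((r : ℤ) - 1 - 2 * p)) • ∑ a ∈ Finset.range r, braidCoeff r (m - 1) p a •
        B ((opF r ^ a) (u r p)) ((opE r ^ (a + 1)) (u r m)) +
      ∑ a ∈ Finset.range r, braidCoeff r m (p - 1) a •
        B ((opF r ^ a) (opE r (u r p))) ((opE r ^ a) (u r m)) =
    ∑ a ∈ Finset.range r, braidCoeff r m p a • (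
      B (opE r ((opF r ^ a) (u r p))) ((opK r ^ 2) ((opE r ^ a) (u r m))) +
      B ((opF r ^ a) (u r p)) ((opE r ^ (a + 1)) (u r m))) := by
  obtain ⟨t, rfl⟩ : ∃ t, r = t + 1 := ⟨r - 1, by omega⟩
  have hlast : (opE (t + 1) ^ (t + 1)) (u (t + 1) m) = 0 := by rw [opE_pow_self]; rfl
  have hS : ∀ a : ℕ, braidCoeff (t + 1) m (p - 1) a = braidCoeff (t + 1) m p a *
      qHalf (t + 1) ^ (2 * (((t + 1 : ℕ) : ℤ) - 1 - 2 * (m - a))) := by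
    intro a
    rw [braidCoeff, braidCoeff, mul_assoc _ (_ ^ _), ← zpow_add₀ (qHalf_ne_zero _)]
    congr 2
    ring
  simp only [hS, opK_sq_opE_pow_u hm, map_smul, smul_add, Finset.sum_add_distrib,
    Finset.smul_sum, smul_smul]
  -- The top terms vanish because `E^r = 0`. Splitting off the bottom terms of the other sums aligns
  -- `a` with `a + 1`.
  rw [Finset.sum_range_succ _ t, hlast, map_zero, smul_zero, add_zero,
    Finset.sum_range_succ (fun a => braidCoeff (t + 1) m p a •
      B ((opF (t + 1) ^ a) (u (t + 1) p)) ((opE (t + 1) ^ (a + 1)) (u (t + 1) m))) t, hlast,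
    map_zero, smul_zero, add_zero, Finset.sum_range_succ' _ t, Finset.sum_range_succ' _ t]
  have : ∀ a ∈ Finset.range t, (qHalf (t + 1) ^ (2 * (((t + 1 : ℕ) : ℤ) - 1 - 2 * p)) *
      braidCoeff (t + 1) (m - 1) p a) •
        B ((opF (t + 1) ^ a) (u (t + 1) p)) ((opE (t + 1) ^ (a + 1)) (u (t + 1) m)) =
      (braidCoeff (t + 1) m p (a + 1) * (qInt (t + 1) (a + 1) *
        qInt (t + 1) (((t + 1 : ℕ) : ℤ) - 1 - 2 * p - a)) *
        qHalf (t + 1) ^ (2 * (((t + 1 : ℕ) : ℤ) - 1 - 2 * (m - (a + 1 : ℕ)))) +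
        braidCoeff (t + 1) m p a) •
        B ((opF (t + 1) ^ a) (u (t + 1) p)) ((opE (t + 1) ^ (a + 1)) (u (t + 1) m)) := by
    intro a ha
    rw [braidCoeff_opE_rec hr (by simpa using ha)]
  rw [Finset.sum_congr rfl this]
  simp only [opE_opF_pow_u hr hp, map_add, map_smul, LinearMap.add_apply, LinearMap.smul_apply,
    smul_add, add_smul, Finset.sum_add_distrib, smul_smul, pow_zero, Module.End.one_apply]
  simp only [mul_right_comm, mul_assoc]
  abel

theorem sum_braid_opF {r m p : ℕ} {M : Type*} [AddCommGroup M] [Module ℂ M] (hr : 2 ≤ r)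
    (hm : m < r) (B : V r →ₗ[ℂ] V r →ₗ[ℂ] M) :
    ∑ a ∈ Finset.range r, braidCoeff r (m + 1) p a •
        B ((opF r ^ a) (u r p)) ((opE r ^ a) (opF r (u r m))) +
      qHalf r ^ (-2 * ((r : ℤ) - 1 - 2 * m)) • ∑ a ∈ Finset.range r, braidCoeff r m (p + 1) a •
        B ((opF r ^ (a + 1)) (u r p)) ((opE r ^ a) (u r m)) =
    ∑ a ∈ Finset.range r, braidCoeff r m p a • (
      B ((opF r ^ (a + 1)) (u r p)) ((opE r ^ a) (u r m)) +
      B ((opKInv r ^ 2) ((opF r ^ a) (u r p))) (opF r ((opE r ^ a) (u r m)))) := by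
  obtain ⟨t, rfl⟩ : ∃ t, r = t + 1 := ⟨r - 1, by omega⟩
  have hlast : (opF (t + 1) ^ (t + 1)) (u (t + 1) p) = 0 := opF_pow_u_eq_zero hr (by omega)
  have hS : ∀ a : ℕ, braidCoeff (t + 1) (m + 1) p a = braidCoeff (t + 1) m p a *
      qHalf (t + 1) ^ (-2 * (((t + 1 : ℕ) : ℤ) - 1 - 2 * (p + a))) := by
    intro a
    rw [braidCoeff, braidCoeff, mul_assoc _ (_ ^ _), ← zpow_add₀ (qHalf_ne_zero _)]
    congr 2
    ring
  simp only [opKInv_sq_opF_pow_u hr, map_smul, LinearMap.smul_apply, smul_add,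
    Finset.sum_add_distrib, Finset.smul_sum, smul_smul, ← hS]
  rw [Finset.sum_range_succ' _ t, Finset.sum_range_succ _ t, hlast,
    Finset.sum_range_succ (fun a => braidCoeff (t + 1) m p a •
      B ((opF (t + 1) ^ (a + 1)) (u (t + 1) p)) ((opE (t + 1) ^ a) (u (t + 1) m))) t, hlast,
    Finset.sum_range_succ' _ t]
  simp only [map_zero, LinearMap.zero_apply, smul_zero, add_zero]
  have : ∀ a ∈ Finset.range t, braidCoeff (t + 1) m p a •
        B ((opF (t + 1) ^ (a + 1)) (u (t + 1) p)) ((opE (t + 1) ^ a) (u (t + 1) m)) =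
      (braidCoeff (t + 1) (m + 1) p (a + 1) * (qInt (t + 1) (a + 1) *
        qInt (t + 1) (((t + 1 : ℕ) : ℤ) - 1 - 2 * m + a)) +
        qHalf (t + 1) ^ (-2 * (((t + 1 : ℕ) : ℤ) - 1 - 2 * m)) * braidCoeff (t + 1) m (p + 1) a) •
        B ((opF (t + 1) ^ (a + 1)) (u (t + 1) p)) ((opE (t + 1) ^ a) (u (t + 1) m)) := by
    intro a ha
    rw [braidCoeff_opF_rec hr (by simpa using ha)]
  rw [Finset.sum_congr rfl this]
  simp only [opE_pow_opF_u hr hm, map_add, map_smul, smul_add, add_smul, Finset.sum_add_distrib, smul_smul, pow_zero, Module.End.one_apply]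
  abel

end Steinberg

end

noncomputable section

namespace Steinberg

/-! ### Properties of the braid operators -/

theorem sigmaOp_zero_cons_opE {n r m p : ℕ} (hr : 2 ≤ r) (hm : m < r) (x : TensorPow n r) :
    sigmaOp (n + 2) r ⟨0, Nat.succ_pos n⟩ (cons (opE r (u r m)) (cons (u r p) x)) =
      ∑ a ∈ Finset.range r, braidCoeff r (m - 1) p a •
        cons ((opF r ^ a) (u r p)) (cons ((opE r ^ (a + 1)) (u r m)) x) := by
  simp only [pow_succ, Module.End.mul_apply]
  cases m with
  | zero => simp [opE_u_zero]
  | succ m =>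
    rw [opE_u_succ hm, sigmaOp_zero_cons hr]
    simp

theorem sigmaOp_zero_cons_cons_opE {n r m p : ℕ} (hr : 2 ≤ r) (hp : p < r) (x : TensorPow n r) :
    sigmaOp (n + 2) r ⟨0, Nat.succ_pos n⟩ (cons (u r m) (cons (opE r (u r p)) x)) =
      ∑ a ∈ Finset.range r, braidCoeff r m (p - 1) a •
        cons ((opF r ^ a) (opE r (u r p))) (cons ((opE r ^ a) (u r m)) x) := by
  cases p with
  | zero => simp [opE_u_zero]
  | succ p =>
    rw [opE_u_succ hp, sigmaOp_zero_cons hr]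
    simp

theorem sigmaOp_zero_cons_opF {n r m p : ℕ} (hr : 2 ≤ r) (x : TensorPow n r) :
    sigmaOp (n + 2) r ⟨0, Nat.succ_pos n⟩ (cons (opF r (u r m)) (cons (u r p) x)) =
      ∑ a ∈ Finset.range r, braidCoeff r (m + 1) p a •
        cons ((opF r ^ a) (u r p)) (cons ((opE r ^ a) (opF r (u r m))) x) := by
  rw [opF_u hr, map_smul, LinearMap.smul_apply, map_smul, sigmaOp_zero_cons hr, Finset.smul_sum]
  refine Finset.sum_congr rfl fun a _ => ?_
  simp only [map_smul, LinearMap.smul_apply]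
  rw [smul_comm]
  push_cast
  rfl

theorem sigmaOp_zero_cons_cons_opF {n r m p : ℕ} (hr : 2 ≤ r) (x : TensorPow n r) :
    sigmaOp (n + 2) r ⟨0, Nat.succ_pos n⟩ (cons (u r m) (cons (opF r (u r p)) x)) =
      ∑ a ∈ Finset.range r, braidCoeff r m (p + 1) a •
        cons ((opF r ^ (a + 1)) (u r p)) (cons ((opE r ^ a) (u r m)) x) := by
  simp only [pow_succ _ _, Module.End.mul_apply]
  rw [opF_u hr, map_smul, LinearMap.smul_apply, map_smul, map_smul, sigmaOp_zero_cons hr,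
    Finset.smul_sum]
  refine Finset.sum_congr rfl fun a _ => ?_
  simp only [map_smul, LinearMap.smul_apply]
  rw [smul_comm]
  push_cast
  rfl

/-- Every crossing is a crossing of the first two strands preceded by spectator strands, so local
statements need only be checked there and propagated through `cons`. -/
theorem sigmaOp_induction {P : ∀ n, Fin (n - 1) → Prop}
    (zero : ∀ n, P (n + 2) ⟨0, Nat.succ_pos n⟩)
    (succ : ∀ n i (hi : i + 1 < n + 1), P (n + 1) ⟨i, Nat.lt_of_succ_lt_succ hi⟩ →
      P (n + 2) ⟨i + 1, hi⟩) (n : ℕ) (i : Fin (n - 1)) : P n i := by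
  obtain ⟨i, hi⟩ := i
  induction i generalizing n with
  | zero =>
    obtain ⟨n, rfl⟩ : ∃ k, n = k + 2 := ⟨n - 2, by omega⟩
    exact zero n
  | succ i ih =>
    obtain ⟨n, rfl⟩ : ∃ k, n = k + 2 := ⟨n - 2, by omega⟩
    exact succ n i hi (ih (n + 1) (Nat.lt_of_succ_lt_succ hi))

theorem sigmaOp_mem {n r : ℕ} (hr : 2 ≤ r) (i : Fin (n - 1)) {ℓ : ℤ} {x : TensorPow n r}
    (hx : x ∈ degreeSpace n r ℓ) : sigmaOp n r i x ∈ degreeSpace n r ℓ := by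
  refine sigmaOp_induction (P := fun n i => ∀ ℓ, ∀ x ∈ degreeSpace n r ℓ,
    sigmaOp n r i x ∈ degreeSpace n r ℓ) ?_ ?_ n i ℓ x hx
  · intro n ℓ x hx
    refine degreeSpace_succ_le (S := (degreeSpace (n + 2) r ℓ).comap (sigmaOp (n + 2) r _))
      (fun m hm x hx => ?_) hx
    refine degreeSpace_succ_le
      (S := ((degreeSpace (n + 2) r ℓ).comap (sigmaOp (n + 2) r _)).comap (cons (u r m)))
      (fun p hp x hx => ?_) hx
    simp only [Submodule.mem_comap]
    rw [sigmaOp_zero_cons hr]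
    refine Submodule.sum_mem _ fun a _ => Submodule.smul_mem _ _ ?_
    rw [opE_pow_u hm]
    split_ifs with h
    · rw [opF_pow_u hr, map_smul]
      refine Submodule.smul_mem _ _ ?_
      rcases lt_or_ge (p + a) r with h' | h'
      · have := cons_mem_degreeSpace h' (cons_mem_degreeSpace (by omega : m - a < r) hx)
        rwa [show ((p + a : ℕ) : ℤ) + ((m - a : ℕ) + (ℓ - m - p)) = ℓ by
          push_cast [h]; ring] at this
      · rw [u_eq_zero h', map_zero]
        exact Submodule.zero_mem _
    · simp
  · intro n i hi ih ℓ x hx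
    refine degreeSpace_succ_le (S := (degreeSpace (n + 2) r ℓ).comap (sigmaOp (n + 2) r _))
      (fun m hm x hx => ?_) hx
    rw [Submodule.mem_comap, sigmaOp_succ_cons]
    have := cons_mem_degreeSpace hm (ih _ x hx)
    rwa [show (m : ℤ) + (ℓ - m) = ℓ by ring] at this

theorem commute_sigmaOp_tensorKSq {n r : ℕ} (hr : 2 ≤ r) (i : Fin (n - 1)) :
    Commute (sigmaOp n r i) (tensorKSq n r) := by
  refine hom_ext_degreeSpace fun ℓ x hx => ?_
  simp only [Module.End.mul_apply]
  rw [tensorKSq_apply hx, tensorKSq_apply (sigmaOp_mem hr i hx), map_smul]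

theorem commute_sigmaOp_tensorH {n r : ℕ} (hr : 2 ≤ r) (i : Fin (n - 1)) :
    Commute (sigmaOp n r i) (tensorH n r) := by
  refine hom_ext_degreeSpace fun ℓ x hx => ?_
  simp only [Module.End.mul_apply]
  rw [tensorH_apply hx, tensorH_apply (sigmaOp_mem hr i hx), map_smul]

theorem commute_sigmaOp_tensorE {n r : ℕ} (hr : 2 ≤ r) (i : Fin (n - 1)) :
    Commute (sigmaOp n r i) (tensorE n r) := by
  refine sigmaOp_induction (P := fun n i => Commute (sigmaOp n r i) (tensorE n r)) ?_ ?_ n i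
  · intro n
    refine hom_ext_cons_cons fun m hm p hp x => ?_
    have key := sum_braid_opE hr hm hp
      (LinearMap.mk₂ ℂ (fun y z => cons y (cons z (tensorKSq n r x))) (by simp) (by simp)
        (by simp) (by simp))
    simp only [LinearMap.mk₂_apply] at key
    simp only [Module.End.mul_apply]
    rw [tensorE_cons, tensorE_cons, tensorKSq_cons, opK_pow_u, sigmaOp_zero_cons hr]
    simp only [map_add, map_smul, map_sum, LinearMap.smul_apply]
    rw [sigmaOp_zero_cons_opE hr hm, sigmaOp_zero_cons_cons_opE hr hp, sigmaOp_zero_cons hr]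
    simp only [tensorE_cons, tensorKSq_cons, map_add, smul_add, Finset.sum_add_distrib,
      pow_succ' (opE r), Module.End.mul_apply, Nat.cast_ofNat] at key ⊢
    rw [← add_assoc, ← add_assoc]
    exact congrArg₂ _ key rfl
  · intro n i hi ih
    refine hom_ext_cons fun m hm x => ?_
    have hK := LinearMap.congr_fun
      (commute_sigmaOp_tensorKSq hr (n := n + 1) ⟨i, Nat.lt_of_succ_lt_succ hi⟩).eq x
    have hE := LinearMap.congr_fun ih.eq x
    simp only [Module.End.mul_apply] at hK hE ⊢
    simp only [tensorE_cons, map_add, sigmaOp_succ_cons, hK, hE]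

theorem commute_sigmaOp_tensorF {n r : ℕ} (hr : 2 ≤ r) (i : Fin (n - 1)) :
    Commute (sigmaOp n r i) (tensorF n r) := by
  refine sigmaOp_induction (P := fun n i => Commute (sigmaOp n r i) (tensorF n r)) ?_ ?_ n i
  · intro n
    refine hom_ext_cons_cons fun m hm p hp x => ?_
    have key := sum_braid_opF (p := p) hr hm
      (LinearMap.mk₂ ℂ (fun y z => cons y (cons z x)) (by simp) (by simp)
        (by simp) (by simp))
    simp only [LinearMap.mk₂_apply] at key
    -- The braiding commutes with `k⁻² ⊗ k⁻²`, since each term `F^a ⊗ E^a` preserves the total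
    -- degree `m + p`. This handles the part of the coproduct where `F` acts beyond the two strands.
    have hx : qHalf r ^ (-2 * ((r : ℤ) - 1 - 2 * p)) • qHalf r ^ (-2 * ((r : ℤ) - 1 - 2 * m)) •
        ∑ a ∈ Finset.range r, braidCoeff r m p a •
          cons ((opF r ^ a) (u r p)) (cons ((opE r ^ a) (u r m)) (tensorF n r x)) =
        ∑ a ∈ Finset.range r, braidCoeff r m p a • cons ((opKInv r ^ 2) ((opF r ^ a) (u r p)))
          (cons ((opKInv r ^ 2) ((opE r ^ a) (u r m))) (tensorF n r x)) := by
      rw [Finset.smul_sum, Finset.smul_sum]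
      refine Finset.sum_congr rfl fun a _ => ?_
      rw [opKInv_sq_opF_pow_u hr, opE_pow_u hm]
      split_ifs with h
      · rw [opKInv_sq_u]
        simp only [map_smul, LinearMap.smul_apply, smul_smul]
        congr 1
        rw [← mul_assoc, ← zpow_add₀ (qHalf_ne_zero r), ← zpow_add₀ (qHalf_ne_zero r), mul_comm]
        push_cast [h]
        congr 2
        ring
      · simp
    simp only [Module.End.mul_apply]
    rw [tensorF_cons, tensorF_cons, opKInv_sq_u, opKInv_sq_u, sigmaOp_zero_cons hr]
    simp only [map_add, map_smul, map_sum, LinearMap.smul_apply]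
    rw [sigmaOp_zero_cons_opF hr, sigmaOp_zero_cons_cons_opF hr, sigmaOp_zero_cons hr]
    simp only [tensorF_cons, map_add, smul_add, Finset.sum_add_distrib, pow_succ' (opF r),
      Module.End.mul_apply] at key ⊢
    rw [← add_assoc, ← add_assoc]
    exact congrArg₂ _ key hx
  · intro n i hi ih
    refine hom_ext_cons fun m hm x => ?_
    have hF := LinearMap.congr_fun ih.eq x
    simp only [Module.End.mul_apply] at hF ⊢
    simp only [tensorF_cons, map_add, sigmaOp_succ_cons, hF]

/-! ### Braid relations and invertibility from `F`-equivariance -/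

/-- From `F(u_m ⊗ x) = [m+1]² u_{m+1} ⊗ x + q^{…} u_m ⊗ F x` and `[m+1] ≠ 0`, the values at
`u_{m+1}` follow from those at `u_m`. -/
theorem hom_ext_tensorF {n r : ℕ} (hr : 2 ≤ r) {A B : Module.End ℂ (TensorPow (n + 1) r)}
    (hA : Commute A (tensorF (n + 1) r)) (hB : Commute B (tensorF (n + 1) r))
    (h : ∀ x, A (cons (u r 0) x) = B (cons (u r 0) x)) : A = B := by
  refine hom_ext_cons fun m hm x => ?_
  induction m generalizing x with
  | zero => exact h x
  | succ m ih =>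
    have ih' := ih (by omega)
    have h1 := LinearMap.congr_fun hA.eq (cons (u r m) x)
    have h2 := LinearMap.congr_fun hB.eq (cons (u r m) x)
    simp only [Module.End.mul_apply] at h1 h2
    rw [← ih', ← h1] at h2
    simp only [tensorF_cons, opF_u hr, opKInv_sq_u, map_add, map_smul, LinearMap.smul_apply,
      ih'] at h2
    have h3 := add_right_cancel h2
    have hne : qInt r (m + 1) ^ 2 ≠ 0 := by
      refine pow_ne_zero _ fun h => ?_
      rw [qInt, div_eq_zero_iff] at h
      exact h.elim (qNum_ne_zero hr (by omega) (by omega)) (qNum_one_ne_zero hr)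
    exact (smul_right_injective _ hne h3).symm

theorem sigmaOp_zero_cons_u_zero {n r : ℕ} (hr : 2 ≤ r) (p : ℕ) (x : TensorPow n r) :
    sigmaOp (n + 2) r ⟨0, Nat.succ_pos n⟩ (cons (u r 0) (cons (u r p) x)) =
      qHalf r ^ (-2 * ((r : ℤ) - 1) * p) • cons (u r p) (cons (u r 0) x) := by
  rw [sigmaOp_zero_cons hr, Finset.sum_eq_single_of_mem 0 (by simp; omega)]
  · simp [braidCoeff, qNumFactorial_zero]
  · intro a _ ha
    rw [opE_pow_u (by omega), if_neg (by omega)]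
    simp

/-- By `F`-equivariance it suffices to start with `u_0` on the first strand. Both sides then braid
the other two vectors and carry `u_0` past them; only the accumulated scalars need comparing. -/
theorem sigmaOp_braid_zero {n r : ℕ} (hr : 2 ≤ r) :
    sigmaOp (n + 3) r ⟨0, Nat.succ_pos _⟩ * sigmaOp (n + 3) r ⟨1, Nat.succ_lt_succ n.succ_pos⟩ *
      sigmaOp (n + 3) r ⟨0, Nat.succ_pos _⟩ =
    sigmaOp (n + 3) r ⟨1, Nat.succ_lt_succ n.succ_pos⟩ * sigmaOp (n + 3) r ⟨0, Nat.succ_pos _⟩ *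
      sigmaOp (n + 3) r ⟨1, Nat.succ_lt_succ n.succ_pos⟩ := by
  have h0 := commute_sigmaOp_tensorF hr (n := n + 3) ⟨0, Nat.succ_pos _⟩
  have h1 := commute_sigmaOp_tensorF hr (n := n + 3) ⟨1, Nat.succ_lt_succ n.succ_pos⟩
  refine hom_ext_tensorF hr ((h0.mul_left h1).mul_left h0) ((h1.mul_left h0).mul_left h1) ?_
  intro x
  rw [← LinearMap.comp_apply, ← LinearMap.comp_apply]
  refine LinearMap.congr_fun (hom_ext_cons_cons fun m hm p hp x => ?_) x
  have hs : ∀ y (x : TensorPow (n + 2) r),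
      sigmaOp (n + 3) r ⟨1, Nat.succ_lt_succ n.succ_pos⟩ (cons y x) =
      cons y (sigmaOp (n + 2) r ⟨0, Nat.succ_pos _⟩ x) := fun y x => sigmaOp_succ_cons _ y x
  simp only [LinearMap.comp_apply, Module.End.mul_apply]
  rw [sigmaOp_zero_cons_u_zero hr, map_smul, map_smul, hs, hs, sigmaOp_zero_cons_u_zero hr,
    map_smul, map_smul, sigmaOp_zero_cons hr, sigmaOp_zero_cons hr, map_sum, map_sum, map_sum,
    Finset.smul_sum, Finset.smul_sum]
  refine Finset.sum_congr rfl fun a _ => ?_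
  rw [opF_pow_u hr, opE_pow_u hm]
  split_ifs with h
  · simp only [map_smul, LinearMap.smul_apply, sigmaOp_zero_cons_u_zero hr, hs, smul_smul]
    congr 1
    -- The scalar for moving `u_0` depends only on the total degree, and `(p + a) + (m - a) = m +
    -- p`.
    have : qHalf r ^ (-2 * ((r : ℤ) - 1) * m) * qHalf r ^ (-2 * ((r : ℤ) - 1) * p) =
      qHalf r ^ (-2 * ((r : ℤ) - 1) * (p + a : ℕ)) *
        qHalf r ^ (-2 * ((r : ℤ) - 1) * (m - a : ℕ)) := by
      rw [← zpow_add₀ (qHalf_ne_zero r), ← zpow_add₀ (qHalf_ne_zero r)]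
      push_cast [h]
      congr 1
      ring
    linear_combination (braidCoeff r m p a * ∏ i ∈ Finset.range a, qInt r (p + i + 1) ^ 2) * this
  · simp

theorem sigmaOp_braid {n r : ℕ} (hr : 2 ≤ r) (i : ℕ) (hi : i + 1 < n - 1) :
    sigmaOp n r ⟨i, by omega⟩ * sigmaOp n r ⟨i + 1, hi⟩ * sigmaOp n r ⟨i, by omega⟩ =
    sigmaOp n r ⟨i + 1, hi⟩ * sigmaOp n r ⟨i, by omega⟩ * sigmaOp n r ⟨i + 1, hi⟩ := by
  induction i generalizing n with
  | zero =>
    obtain ⟨n, rfl⟩ : ∃ k, n = k + 3 := ⟨n - 3, by omega⟩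
    exact sigmaOp_braid_zero hr
  | succ i ih =>
    obtain ⟨n, rfl⟩ : ∃ k, n = k + 2 := ⟨n - 2, by omega⟩
    refine hom_ext_cons fun m hm x => ?_
    have := LinearMap.congr_fun (ih (n := n + 1) (Nat.lt_of_succ_lt_succ hi)) x
    simp only [Module.End.mul_apply] at this ⊢
    simp only [sigmaOp_succ_cons, this]

theorem sigmaOp_comm {n r : ℕ} (hr : 2 ≤ r) (i j : ℕ) (hij : i + 1 < j) (hj : j < n - 1) :
    sigmaOp n r ⟨i, by omega⟩ * sigmaOp n r ⟨j, hj⟩ =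
      sigmaOp n r ⟨j, hj⟩ * sigmaOp n r ⟨i, by omega⟩ := by
  induction i generalizing n j with
  | zero =>
    obtain ⟨n, rfl⟩ : ∃ k, n = k + 3 := ⟨n - 3, by omega⟩
    obtain ⟨j, rfl⟩ : ∃ k, j = k + 2 := ⟨j - 2, by omega⟩
    refine hom_ext_cons_cons fun m hm p hp x => ?_
    have hs : ∀ (y z : V r) (x : TensorPow (n + 1) r), sigmaOp (n + 3) r ⟨j + 2, hj⟩
        (cons y (cons z x)) =
        cons y (cons z (sigmaOp (n + 1) r ⟨j, Nat.lt_of_succ_lt_succ (Nat.lt_of_succ_lt_succ hj)⟩ x)) := by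
      intro y z x
      obtain ⟨n, rfl⟩ : ∃ k, n = k + 1 := ⟨n - 1, by omega⟩
      refine (sigmaOp_succ_cons _ y _).trans ?_
      rw [sigmaOp_succ_cons]
    simp only [Module.End.mul_apply]
    rw [hs, sigmaOp_zero_cons hr, sigmaOp_zero_cons hr, map_sum]
    simp only [map_smul, hs]
  | succ i ih =>
    obtain ⟨n, rfl⟩ : ∃ k, n = k + 2 := ⟨n - 2, by omega⟩
    obtain ⟨j, rfl⟩ : ∃ k, j = k + 1 := ⟨j - 1, by omega⟩
    refine hom_ext_cons fun m hm x => ?_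
    have := LinearMap.congr_fun (ih (n := n + 1) j (by omega) (by omega)) x
    simp only [Module.End.mul_apply] at this ⊢
    simp only [sigmaOp_succ_cons, this]

theorem cons_mem_of_u {n r : ℕ} {S : Submodule ℂ (TensorPow (n + 1) r)}
    (h : ∀ m < r, ∀ x, cons (u r m) x ∈ S) : S = ⊤ := by
  have : S.mkQ = 0 := hom_ext_cons fun m hm x => by
    simpa using h m hm x
  rw [← Submodule.ker_mkQ S, this, LinearMap.ker_zero]

/-- The range is stable under `F` and contains every `u_m ⊗ u_0 ⊗ x`, the image of a multiple of
`u_0 ⊗ u_m ⊗ x`. Applying `F` then raises the index of the second factor. Surjectivity suffices for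
invertibility in finite dimension. -/
theorem range_sigmaOp {n r : ℕ} (hr : 2 ≤ r) (i : Fin (n - 1)) :
    LinearMap.range (sigmaOp n r i) = ⊤ := by
  refine sigmaOp_induction (P := fun n i => LinearMap.range (sigmaOp n r i) = ⊤) ?_ ?_ n i
  · intro n
    have hF : ∀ v ∈ LinearMap.range (sigmaOp (n + 2) r ⟨0, Nat.succ_pos n⟩),
        tensorF (n + 2) r v ∈ LinearMap.range (sigmaOp (n + 2) r ⟨0, Nat.succ_pos n⟩) := by
      rintro _ ⟨v, rfl⟩
      exact ⟨tensorF (n + 2) r v, LinearMap.congr_fun (commute_sigmaOp_tensorF hr _).eq v⟩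
    have key : ∀ p < r, ∀ m x, cons (u r m) (cons (u r p) x) ∈
        LinearMap.range (sigmaOp (n + 2) r ⟨0, Nat.succ_pos n⟩) := by
      intro p hp
      induction p with
      | zero =>
        intro m x
        have h0 : qHalf r ^ (-2 * ((r : ℤ) - 1) * m) ≠ 0 := zpow_ne_zero _ (qHalf_ne_zero r)
        rw [← Submodule.smul_mem_iff _ h0, ← sigmaOp_zero_cons_u_zero hr]
        exact LinearMap.mem_range_self _ _
      | succ p ih =>
        intro m x
        have ih' := ih (by omega)
        have h := hF _ (ih' m x)
        rw [tensorF_cons, tensorF_cons, opF_u hr, opF_u hr, opKInv_sq_u, opKInv_sq_u] at h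
        simp only [map_add, map_smul, LinearMap.smul_apply] at h
        have hne : qInt r (p + 1) ^ 2 ≠ 0 := by
          refine pow_ne_zero _ fun h => ?_
          rw [qInt, div_eq_zero_iff] at h
          exact h.elim (qNum_ne_zero hr (by omega) (by omega)) (qNum_one_ne_zero hr)
        -- Of the three terms of `F(u_m ⊗ u_p ⊗ x)`, those with `u_p` still in second place lie in
        -- the range by induction; the one with `u_{p+1}` remains.
        have h1 := (Submodule.add_mem_iff_right _ (Submodule.smul_mem _ _ (ih' _ _))).1 h
        have h2 := (Submodule.add_mem_iff_left _ (Submodule.smul_mem _ _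
          (Submodule.smul_mem _ _ (ih' _ _)))).1 h1
        rwa [Submodule.smul_mem_iff _ hne,
          Submodule.smul_mem_iff _ (zpow_ne_zero _ (qHalf_ne_zero r))] at h2
    refine cons_mem_of_u fun m hm x => ?_
    have : (LinearMap.range (sigmaOp (n + 2) r ⟨0, Nat.succ_pos n⟩)).comap (cons (u r m)) = ⊤ :=
      cons_mem_of_u fun p hp x => key p hp m x
    exact (this.ge : _) (Submodule.mem_top (x := x))
  · intro n i hi ih
    refine cons_mem_of_u fun m hm x => ?_
    obtain ⟨y, rfl⟩ := LinearMap.range_eq_top.1 ih x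
    exact ⟨cons (u r m) y, sigmaOp_succ_cons hi _ y⟩

theorem isUnit_sigmaOp {n r : ℕ} (hr : 2 ≤ r) (i : Fin (n - 1)) : IsUnit (sigmaOp n r i) :=
  (LinearMap.isUnit_iff_range_eq_top _).2 (range_sigmaOp hr i)

end Steinberg

end

/-! ### Half twists in a monoid -/

section Twist

variable {M : Type*} [Monoid M]

/-- `σ_0 σ_1 ⋯ σ_{k-1}`. -/
def ascProd (σ : ℕ → M) : ℕ → M
  | 0 => 1
  | k + 1 => ascProd σ k * σ k

/-- `σ_{k-1} ⋯ σ_1 σ_0`. -/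
def descProd (σ : ℕ → M) : ℕ → M
  | 0 => 1
  | k + 1 => σ k * descProd σ k

/-- The half twist on `k + 1` strands. -/
def halfTwistProd (σ : ℕ → M) : ℕ → M
  | 0 => 1
  | k + 1 => ascProd σ (k + 1) * halfTwistProd σ k

theorem ascProd_succ' (σ : ℕ → M) (k : ℕ) :
    ascProd σ (k + 1) = σ 0 * ascProd (fun i => σ (i + 1)) k := by
  induction k with
  | zero => simp [ascProd]
  | succ k ih => rw [ascProd, ih, ascProd, mul_assoc]

theorem descProd_succ' (σ : ℕ → M) (k : ℕ) :
    descProd σ (k + 1) = descProd (fun i => σ (i + 1)) k * σ 0 := by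
  induction k with
  | zero => simp [descProd]
  | succ k ih => rw [descProd, ih, descProd, mul_assoc]

theorem commute_ascProd {σ : ℕ → M} {x : M} {k : ℕ} (h : ∀ i < k, Commute x (σ i)) :
    Commute x (ascProd σ k) := by
  induction k with
  | zero => exact Commute.one_right x
  | succ k ih => exact (ih fun i hi => h i (by omega)).mul_right (h k (by omega))

theorem commute_halfTwistProd {σ : ℕ → M} {x : M} {k : ℕ} (h : ∀ i < k, Commute x (σ i)) :
    Commute x (halfTwistProd σ k) := by
  induction k with
  | zero => exact Commute.one_right x
  | succ k ih => exact (commute_ascProd h).mul_right (ih fun i hi => h i (by omega))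

theorem halfTwistProd_eq_prod (σ : ℕ → M) (k : ℕ) :
    halfTwistProd σ k = ((List.range k).map fun t => ascProd σ (k - t)).prod := by
  induction k with
  | zero => simp [halfTwistProd]
  | succ k ih =>
    rw [halfTwistProd, ih, List.range_succ_eq_map, List.map_cons, List.prod_cons, List.map_map]
    simp [Function.comp_def]

theorem ascProd_eq_prod (σ : ℕ → M) (k : ℕ) : ascProd σ k = ((List.range k).map σ).prod := by
  induction k with
  | zero => simp [ascProd]
  | succ k ih => simp [ascProd, ih, List.range_succ]

theorem BraidGroup.map_halfTwist {n : ℕ} (φ : BraidGroup n →* M) (σ : ℕ → M)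
    (h : ∀ i, φ (gen n i) = σ i) : φ (halfTwist n) = halfTwistProd σ (n - 1) := by
  rw [halfTwist, halfTwistProd_eq_prod, map_list_prod, List.map_map]
  congr 1
  refine List.map_congr_left fun t ht => ?_
  rw [Function.comp_apply, delta, map_list_prod, List.map_map, ascProd_eq_prod]
  congr 1
  -- The factor `δ_{n-t}` is the ascending product of length `n - t - 1`, which is `(n - 1) - t` as
  -- required.
  have h1 : (φ ∘ gen n) = σ ∘ Fin.val := funext h
  rw [h1, ← List.map_map, List.map_take, List.map_coe_finRange_eq_range, List.take_range]
  congr 2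
  omega

/-- Conjugation by `δ` shifts generators by one: the far factors commute and one braid relation does
the shift. -/
theorem ascProd_mul_gen {σ : ℕ → M} {N : ℕ}
    (hc : ∀ i j, i + 1 < j → j < N → Commute (σ i) (σ j))
    (hb : ∀ i, i + 1 < N → σ i * σ (i + 1) * σ i = σ (i + 1) * σ i * σ (i + 1))
    {k i : ℕ} (hi : i < k) (hk : k < N) :
    ascProd σ (k + 1) * σ i = σ (i + 1) * ascProd σ (k + 1) := by
  induction k with
  | zero => omega
  | succ k ih =>
    rcases Nat.lt_succ_iff_lt_or_eq.1 hi with h | rfl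
    · rw [ascProd, mul_assoc, ← (hc i (k + 1) (by omega) hk).eq, ← mul_assoc, ih h (by omega),
        mul_assoc]
    · have : Commute (σ (i + 1)) (ascProd σ i) :=
        commute_ascProd fun t ht => (hc t (i + 1) (by omega) hk).symm
      calc ascProd σ (i + 2) * σ i = ascProd σ i * (σ i * σ (i + 1) * σ i) := by
            simp only [ascProd, mul_assoc]
        _ = ascProd σ i * σ (i + 1) * (σ i * σ (i + 1)) := by
            rw [hb i hk]
            simp only [mul_assoc]
        _ = σ (i + 1) * ascProd σ (i + 2) := by
            rw [← this.eq]
            simp only [ascProd, mul_assoc]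

theorem ascProd_mul_ascProd {σ : ℕ → M} {N : ℕ}
    (hc : ∀ i j, i + 1 < j → j < N → Commute (σ i) (σ j))
    (hb : ∀ i, i + 1 < N → σ i * σ (i + 1) * σ i = σ (i + 1) * σ i * σ (i + 1))
    {k j : ℕ} (hj : j ≤ k) (hk : k < N) :
    ascProd σ (k + 1) * ascProd σ j = ascProd (fun i => σ (i + 1)) j * ascProd σ (k + 1) := by
  induction j with
  | zero => simp [ascProd]
  | succ j ih =>
    rw [ascProd.eq_2 σ j, ← mul_assoc, ih (by omega), mul_assoc,
      ascProd_mul_gen hc hb (by omega) hk, ascProd.eq_2 _ j, mul_assoc]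

theorem ascProd_mul_halfTwistProd {σ : ℕ → M} {N : ℕ}
    (hc : ∀ i j, i + 1 < j → j < N → Commute (σ i) (σ j))
    (hb : ∀ i, i + 1 < N → σ i * σ (i + 1) * σ i = σ (i + 1) * σ i * σ (i + 1))
    {k j : ℕ} (hj : j ≤ k) (hk : k < N) :
    ascProd σ (k + 1) * halfTwistProd σ j =
      halfTwistProd (fun i => σ (i + 1)) j * ascProd σ (k + 1) := by
  induction j with
  | zero => simp [halfTwistProd]
  | succ j ih =>
    rw [halfTwistProd, ← mul_assoc, ascProd_mul_ascProd hc hb hj hk, mul_assoc, ih (by omega),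
      halfTwistProd, mul_assoc]

/-- A second factorization of the half twist, with the new generators in a descending product on the
right. Combined with the ascending one it isolates the winding of the first strand in the square. -/
theorem halfTwistProd_succ {σ : ℕ → M} {N : ℕ}
    (hc : ∀ i j, i + 1 < j → j < N → Commute (σ i) (σ j))
    {k : ℕ} (hk : k < N) :
    halfTwistProd σ (k + 1) = halfTwistProd σ k * descProd σ (k + 1) := by
  induction k with
  | zero => simp [halfTwistProd, ascProd, descProd]
  | succ k ih =>
    have : Commute (σ (k + 1)) (halfTwistProd σ k) :=
      commute_halfTwistProd fun t ht => (hc t (k + 1) (by omega) hk).symm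
    calc halfTwistProd σ (k + 2)
        = ascProd σ (k + 1) * (σ (k + 1) * halfTwistProd σ k) * descProd σ (k + 1) := by
          rw [halfTwistProd, ih (by omega), ascProd]
          simp only [mul_assoc]
      _ = halfTwistProd σ (k + 1) * descProd σ (k + 2) := by
          rw [this.eq, halfTwistProd, descProd.eq_2 σ (k + 1)]
          simp only [mul_assoc]

/-- One factor of the square is expanded each way; moving the ascending product to the right past
both inner half twists shifts them onto the last strands. -/
theorem halfTwistProd_succ_sq {σ : ℕ → M} {N : ℕ}
    (hc : ∀ i j, i + 1 < j → j < N → Commute (σ i) (σ j))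
    (hb : ∀ i, i + 1 < N → σ i * σ (i + 1) * σ i = σ (i + 1) * σ i * σ (i + 1))
    {k : ℕ} (hk : k < N) :
    halfTwistProd σ (k + 1) ^ 2 = halfTwistProd (fun i => σ (i + 1)) k ^ 2 *
      (ascProd σ (k + 1) * descProd σ (k + 1)) := by
  have h := ascProd_mul_halfTwistProd hc hb le_rfl hk
  calc halfTwistProd σ (k + 1) ^ 2
      = ascProd σ (k + 1) * halfTwistProd σ k * halfTwistProd σ k * descProd σ (k + 1) := by
        rw [pow_two]
        nth_rewrite 2 [halfTwistProd_succ hc hk]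
        rw [halfTwistProd]
        simp only [mul_assoc]
    _ = halfTwistProd (fun i => σ (i + 1)) k * (ascProd σ (k + 1) * halfTwistProd σ k) *
        descProd σ (k + 1) := by
        rw [h, mul_assoc (halfTwistProd _ k), h]
    _ = _ := by
        rw [h, pow_two]
        simp only [mul_assoc]

end Twist

/-! ### The full twist has infinite order -/

/-- The relators are homogeneous, so sending each generator to `1` defines the exponent sum `B_n →
ℤ`, which is positive on the half twist. -/
theorem BraidGroup.fullTwist_pow_ne_one {n r : ℕ} (hn : 2 ≤ n) (hr : r ≠ 0) :
    fullTwist n ^ r ≠ 1 := by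
  have hrel : ∀ x ∈ braidRels n,
      FreeGroup.lift (fun _ : Fin (n - 1) => Multiplicative.ofAdd (1 : ℤ)) x = 1 := by
    rintro x (⟨i, j, _, rfl⟩ | ⟨i, j, _, rfl⟩) <;> simp
  let φ : BraidGroup n →* Multiplicative ℤ := PresentedGroup.toGroup hrel
  have hφ : ∀ i, φ (gen n i) = Multiplicative.ofAdd (1 : ℤ) := fun i => PresentedGroup.toGroup.of hrel
  have hasc : ∀ k : ℕ, (ascProd (fun _ => Multiplicative.ofAdd (1 : ℤ)) k).toAdd = k := by
    intro k
    induction k with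
    | zero => simp [ascProd]
    | succ k ih => simp [ascProd, ih]
  have hpos : ∀ k : ℕ, (k : ℤ) ≤ (halfTwistProd (fun _ => Multiplicative.ofAdd (1 : ℤ)) k).toAdd := by
    intro k
    induction k with
    | zero => simp [halfTwistProd]
    | succ k ih =>
      rw [halfTwistProd, toAdd_mul, hasc]
      omega
  intro h
  have h1 := congrArg (fun x => (φ x).toAdd) h
  simp only [fullTwist, map_pow, map_one, toAdd_pow, toAdd_one,
    BraidGroup.map_halfTwist φ (fun _ => Multiplicative.ofAdd (1 : ℤ)) hφ] at h1
  have h2 := hpos (n - 1)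
  have h3 : (1 : ℤ) ≤ (n - 1 : ℕ) := by omega
  have h4 : (r : ℤ) ≠ 0 := by exact_mod_cast hr
  simp only [nsmul_eq_mul, mul_eq_zero, h4, Nat.cast_ofNat, OfNat.ofNat_ne_zero, false_or] at h1
  omega

/-! ### The braid group representation -/

noncomputable section

namespace Steinberg

theorem lift_braidRels {n r : ℕ} (hr : 2 ≤ r) : ∀ x ∈ braidRels n,
    FreeGroup.lift (fun i => (isUnit_sigmaOp (n := n) hr i).unit) x = 1 := by
  rintro x (⟨i, j, hij, rfl⟩ | ⟨i, j, hij, rfl⟩)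
  · rw [map_mul, map_inv, mul_inv_eq_one]
    apply Units.ext
    simpa using sigmaOp_comm hr i j hij j.2
  · rw [map_mul, map_inv, mul_inv_eq_one]
    apply Units.ext
    have hi : (i : ℕ) + 1 < n - 1 := hij ▸ j.2
    obtain rfl : j = ⟨i + 1, hi⟩ := Fin.ext hij.symm
    simpa using sigmaOp_braid hr i hi

/-- The representation of the braid group on `V^{⊗ n}`. -/
def braidRep (n : ℕ) {r : ℕ} (hr : 2 ≤ r) : Representation ℂ (BraidGroup n) (TensorPow n r) :=
  (Units.coeHom _).comp (PresentedGroup.toGroup (lift_braidRels hr))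

theorem braidRep_gen {n r : ℕ} (hr : 2 ≤ r) (i : Fin (n - 1)) :
    braidRep n hr (BraidGroup.gen n i) = sigmaOp n r i := by
  simp only [braidRep, MonoidHom.comp_apply, BraidGroup.gen]
  rw [PresentedGroup.toGroup.of]
  rfl

theorem commute_braidRep {n r : ℕ} (hr : 2 ≤ r) {A : Module.End ℂ (TensorPow n r)}
    (hA : ∀ i, Commute (sigmaOp n r i) A) (g : BraidGroup n) : Commute (braidRep n hr g) A := by
  have hg : g ∈ Subgroup.closure (Set.range (PresentedGroup.of (rels := braidRels n))) := by
    rw [PresentedGroup.closure_range_of]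
    trivial
  induction hg using Subgroup.closure_induction with
  | mem x hx =>
    obtain ⟨i, rfl⟩ := hx
    have := braidRep_gen hr i
    rw [BraidGroup.gen] at this
    rw [this]
    exact hA i
  | one => rw [map_one]; exact Commute.one_left A
  | mul x y _ _ hx hy => rw [map_mul]; exact hx.mul_left hy
  | inv x _ hx =>
    have h1 : braidRep n hr x⁻¹ * braidRep n hr x = 1 := by rw [← map_mul]; simp
    have h2 : braidRep n hr x * braidRep n hr x⁻¹ = 1 := by rw [← map_mul]; simp
    calc braidRep n hr x⁻¹ * A
        = braidRep n hr x⁻¹ * A * (braidRep n hr x * braidRep n hr x⁻¹) := by rw [h2, mul_one]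
      _ = braidRep n hr x⁻¹ * (A * braidRep n hr x) * braidRep n hr x⁻¹ := by
        simp only [mul_assoc]
      _ = (braidRep n hr x⁻¹ * braidRep n hr x) * A * braidRep n hr x⁻¹ := by
        rw [← hx.eq]; simp only [mul_assoc]
      _ = A * braidRep n hr x⁻¹ := by rw [h1, one_mul]

/-! ### The full twist operator and its recursion in the number of strands -/

/-- The operators `sigmaOp n r i`, extended by `1` to all `i : ℕ`. -/
def sigmaNat (n r i : ℕ) : Module.End ℂ (TensorPow n r) :=
  if h : i < n - 1 then sigmaOp n r ⟨i, h⟩ else 1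

theorem sigmaNat_of_lt {n r i : ℕ} (h : i < n - 1) : sigmaNat n r i = sigmaOp n r ⟨i, h⟩ :=
  dif_pos h

theorem sigmaNat_succ_cons {n r i : ℕ} (y : V r) (x : TensorPow n r) :
    sigmaNat (n + 1) r (i + 1) (cons y x) = cons y (sigmaNat n r i x) := by
  by_cases h : i < n - 1
  · obtain ⟨n, rfl⟩ : ∃ k, n = k + 1 := ⟨n - 1, by omega⟩
    rw [sigmaNat_of_lt h, sigmaNat_of_lt (Nat.succ_lt_succ h)]
    exact sigmaOp_succ_cons _ y x
  · rw [sigmaNat, sigmaNat, dif_neg h, dif_neg (by omega)]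
    rfl

theorem commute_sigmaNat_tensorF {n r : ℕ} (hr : 2 ≤ r) (i : ℕ) :
    Commute (sigmaNat n r i) (tensorF n r) := by
  rw [sigmaNat]
  split_ifs with h
  · exact commute_sigmaOp_tensorF hr _
  · exact Commute.one_left _

theorem ascProd_sigmaNat_cons {n r : ℕ} (k : ℕ) (y : V r) (x : TensorPow n r) :
    ascProd (fun i => sigmaNat (n + 1) r (i + 1)) k (cons y x) =
      cons y (ascProd (sigmaNat n r) k x) := by
  induction k generalizing x with
  | zero => simp [ascProd]
  | succ k ih => rw [ascProd, Module.End.mul_apply, sigmaNat_succ_cons, ih, ascProd]; rfl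

theorem descProd_sigmaNat_cons {n r : ℕ} (k : ℕ) (y : V r) (x : TensorPow n r) :
    descProd (fun i => sigmaNat (n + 1) r (i + 1)) k (cons y x) =
      cons y (descProd (sigmaNat n r) k x) := by
  induction k with
  | zero => simp [descProd]
  | succ k ih => rw [descProd, Module.End.mul_apply, ih, sigmaNat_succ_cons, descProd]; rfl

theorem halfTwistProd_sigmaNat_cons {n r : ℕ} (k : ℕ) (y : V r) (x : TensorPow n r) :
    halfTwistProd (fun i => sigmaNat (n + 1) r (i + 1)) k (cons y x) =
      cons y (halfTwistProd (sigmaNat n r) k x) := by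
  induction k with
  | zero => simp [halfTwistProd]
  | succ k ih =>
    rw [halfTwistProd, Module.End.mul_apply, ih, ascProd_sigmaNat_cons, halfTwistProd]; rfl

/-- The full twist operator on `V^{⊗ n}`. -/
def fullTwistOp (n r : ℕ) : Module.End ℂ (TensorPow n r) :=
  halfTwistProd (sigmaNat n r) (n - 1) ^ 2

theorem braidRep_fullTwist {n r : ℕ} (hr : 2 ≤ r) :
    braidRep n hr (BraidGroup.fullTwist n) = fullTwistOp n r := by
  rw [BraidGroup.fullTwist, map_pow, fullTwistOp,
    BraidGroup.map_halfTwist (braidRep n hr) (sigmaNat n r)]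
  intro i
  rw [braidRep_gen, sigmaNat_of_lt i.2]

/-- The operator by which the first strand winds once around the `n` others. -/
def windOp (n r : ℕ) : Module.End ℂ (TensorPow (n + 1) r) :=
  ascProd (sigmaNat (n + 1) r) n * descProd (sigmaNat (n + 1) r) n

/-- The outermost crossings are peeled off: after the first one, the strand carrying `y` stands in
front and the inner winding does not touch it. -/
theorem windOp_succ_apply {n r : ℕ} (y : V r) (v : TensorPow (n + 2) r)
    (x : TensorPow (n + 1) r) (h : sigmaOp (n + 2) r ⟨0, Nat.succ_pos n⟩ v = cons y x) :
    windOp (n + 1) r v = sigmaOp (n + 2) r ⟨0, Nat.succ_pos n⟩ (cons y (windOp n r x)) := by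
  rw [windOp, ascProd_succ', descProd_succ']
  simp only [Module.End.mul_apply]
  rw [sigmaNat_of_lt (Nat.succ_pos n : 0 < n + 2 - 1), h, descProd_sigmaNat_cons,
    ascProd_sigmaNat_cons]
  rfl

theorem fullTwistOp_succ_apply {n r : ℕ} (hr : 2 ≤ r) (v : TensorPow (n + 1) r) :
    fullTwistOp (n + 1) r v =
      (halfTwistProd (fun i => sigmaNat (n + 1) r (i + 1)) (n - 1) ^ 2) (windOp n r v) := by
  cases n with
  | zero => simp [fullTwistOp, halfTwistProd, windOp, ascProd, descProd]
  | succ n =>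
    have := halfTwistProd_succ_sq (σ := sigmaNat (n + 2) r) (N := n + 1) ?_ ?_ (Nat.lt_succ_self n)
    · exact LinearMap.congr_fun this v
    · intro i j hij hj
      rw [sigmaNat_of_lt (by omega : i < n + 2 - 1), sigmaNat_of_lt (by omega : j < n + 2 - 1)]
      exact sigmaOp_comm hr i j hij (by omega)
    · intro i hi
      rw [sigmaNat_of_lt (by omega : i < n + 2 - 1), sigmaNat_of_lt (by omega : i + 1 < n + 2 - 1)]
      exact sigmaOp_braid hr i (by omega)

theorem shift_fullTwistOp_cons {n r : ℕ} (y : V r) (x : TensorPow n r) :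
    (halfTwistProd (fun i => sigmaNat (n + 1) r (i + 1)) (n - 1) ^ 2) (cons y x) =
      cons y (fullTwistOp n r x) := by
  rw [pow_two, Module.End.mul_apply, halfTwistProd_sigmaNat_cons, halfTwistProd_sigmaNat_cons,
    fullTwistOp, pow_two]
  rfl

theorem commute_fullTwistOp_tensorF {n r : ℕ} (hr : 2 ≤ r) :
    Commute (fullTwistOp n r) (tensorF n r) :=
  (commute_halfTwistProd fun i _ => (commute_sigmaNat_tensorF hr i).symm).symm.pow_left 2

end Steinberg

end

noncomputable section

namespace Steinberg

/-! ### The full twist in terms of `E` and `F` -/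

theorem sum_range_range_eq_sum_antidiagonal {M : Type*} [AddCommMonoid M] (r : ℕ) (f : ℕ → ℕ → M)
    (hf : ∀ a b, r ≤ a + b → f a b = 0) :
    ∑ a ∈ Finset.range r, ∑ b ∈ Finset.range r, f a b =
      ∑ c ∈ Finset.range r, ∑ p ∈ Finset.HasAntidiagonal.antidiagonal c, f p.1 p.2 := by
  simp only [Finset.Nat.sum_antidiagonal_eq_sum_range_succ f]
  rw [Finset.sum_range_diag_flip]
  refine Finset.sum_congr rfl fun a _ => (Finset.sum_subset ?_ ?_).symm
  · exact Finset.range_mono (Nat.sub_le r a)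
  · intro b _ hb
    rw [Finset.mem_range] at hb
    exact hf a b (by omega)

/-- The coefficients of the winding operator on `u_0 ⊗ V_{n,ℓ}`. -/
def windCoeff (r n : ℕ) (ℓ : ℤ) (c : ℕ) : ℂ :=
  qNum r 1 ^ (2 * c) / qNumFactorial r c *
    qHalf r ^ (2 * ((r : ℤ) - 1) * (c - 2 * ℓ - n * c) + 4 * ℓ * c - 3 * c ^ 2 - c)

/-- Matches the induction step of `windOp_cons`: `a` powers of `E` come from the outer crossing and
`b` from the inner winding, and the `q`-binomial formula reassembles them into `E^{a+b}` on one more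
strand. -/
theorem windCoeff_rec {r n : ℕ} (hr : 2 ≤ r) (m ℓ : ℤ) {a b : ℕ} (h : a + b < r) :
    qHalf r ^ (-2 * ((r : ℤ) - 1) * m) * (windCoeff r n ℓ b * braidCoeff r m b a) =
      windCoeff r (n + 1) (ℓ + m) (a + b) * (gauss r a b *
        qHalf r ^ (2 * (a : ℤ) * (n * ((r : ℤ) - 1) - 2 * ℓ))) := by
  have h0 := qHalf_ne_zero r
  have h1 := qNumFactorial_ne_zero hr (by omega : a < r)
  have h2 := qNumFactorial_ne_zero hr (by omega : b < r)
  have h3 := qNumFactorial_ne_zero hr h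
  rw [gauss_eq hr h, windCoeff, windCoeff, braidCoeff]
  have key : qHalf r ^ (-2 * ((r : ℤ) - 1) * m) *
      (qHalf r ^ (2 * ((r : ℤ) - 1) * (b - 2 * ℓ - n * b) + 4 * ℓ * b - 3 * b ^ 2 - b) *
      qHalf r ^ ((a : ℤ) * (a - 1) - 2 * (r - 1) * (m + b) + 4 * (m - a) * (b + a))) =
      qHalf r ^ (2 * ((r : ℤ) - 1) * ((a + b : ℕ) - 2 * (ℓ + m) - (n + 1 : ℕ) * (a + b : ℕ)) +
        4 * (ℓ + m) * (a + b : ℕ) - 3 * ((a + b : ℕ) : ℤ) ^ 2 - (a + b : ℕ)) *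
      (qHalf r ^ (2 * (a : ℤ) * b) *
        qHalf r ^ (2 * (a : ℤ) * (n * ((r : ℤ) - 1) - 2 * ℓ))) := by
    simp only [← zpow_add₀ h0]
    push_cast
    congr 1
    ring
  field_simp
  linear_combination (qNum r 1 ^ (2 * (a + b))) * key

/-- Going in, `u_0` merely passes `u_m` with a scalar. The inner winding turns it into the vectors
`F^b u_0`, and only the returning crossing mixes in further terms `F^a ⊗ E^a`. -/
theorem windOp_cons {n r : ℕ} (hr : 2 ≤ r) {ℓ : ℤ} {x : TensorPow n r}
    (hx : x ∈ degreeSpace n r ℓ) : windOp n r (cons (u r 0) x) =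
      ∑ c ∈ Finset.range r, windCoeff r n ℓ c •
        cons ((opF r ^ c) (u r 0)) ((tensorE n r ^ c) x) := by
  induction n generalizing ℓ with
  | zero =>
    by_cases hℓ : ℓ = 0
    · subst hℓ
      rw [Finset.sum_eq_single_of_mem 0 (by simp; omega)]
      · simp [windOp, ascProd, descProd, windCoeff, qNumFactorial_zero]
      · intro c _ hc
        simp [tensorE, sumInsert_zero_left, hc]
    · simp [eq_zero_of_mem_degreeSpace_zero hℓ hx]
  | succ n ih =>
    refine degreeSpace_hom_ext (windOp (n + 1) r ∘ₗ cons (u r 0))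
      (∑ c ∈ Finset.range r, windCoeff r (n + 1) ℓ c •
        cons ((opF r ^ c) (u r 0)) ∘ₗ (tensorE (n + 1) r ^ c)) (fun m hm x hx => ?_) hx |>.trans
      (by simp)
    simp only [LinearMap.comp_apply, LinearMap.sum_apply, LinearMap.smul_apply]
    rw [windOp_succ_apply (qHalf r ^ (-2 * ((r : ℤ) - 1) * m) • u r m) _ (cons (u r 0) x)
      (by rw [sigmaOp_zero_cons_u_zero hr, map_smul, LinearMap.smul_apply]), ih hx]
    have hσ : ∀ (b : ℕ) (x : TensorPow n r), sigmaOp (n + 2) r ⟨0, Nat.succ_pos n⟩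
        (cons (u r m) (cons ((opF r ^ b) (u r 0)) x)) = ∑ a ∈ Finset.range r,
          braidCoeff r m b a • cons ((opF r ^ (a + b)) (u r 0)) (cons ((opE r ^ a) (u r m)) x) := by
      intro b x
      simp only [pow_add, Module.End.mul_apply]
      rw [opF_pow_u hr, zero_add]
      simp only [map_smul, LinearMap.smul_apply]
      rw [sigmaOp_zero_cons hr, Finset.smul_sum]
      exact Finset.sum_congr rfl fun a _ => smul_comm _ _ _
    simp only [map_smul, map_sum, LinearMap.smul_apply, hσ, tensorE_pow_cons _ hx,
      Finset.smul_sum]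
    rw [Finset.sum_comm, sum_range_range_eq_sum_antidiagonal]
    · refine Finset.sum_congr rfl fun c hc => Finset.sum_congr rfl fun p hp => ?_
      rw [Finset.HasAntidiagonal.mem_antidiagonal] at hp
      rw [Finset.mem_range] at hc
      have := windCoeff_rec (n := n) hr m (ℓ - m) (a := p.1) (b := p.2) (by omega)
      rw [sub_add_cancel, hp] at this
      simp only [smul_smul]
      rw [mul_left_comm, this, hp]
    · intro a b hab
      rw [opF_pow_u_eq_zero hr (by omega)]
      simp

/-- The coefficients of `F^a E^a` in the full twist on `V_{n,ℓ}`. -/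
def twistCoeff (r n : ℕ) (ℓ : ℤ) (a : ℕ) : ℂ :=
  qNum r 1 ^ (2 * a) / qNumFactorial r a *
    qHalf r ^ (2 * ((r : ℤ) - 1) * (n * (a - 2 * ℓ)) + a ^ 2 + 3 * a - 4 * ℓ * a + 4 * ℓ * (ℓ - 1))

/-- `∑_a t_a F^a E^a` with the coefficients of the full twist on `V_{n,ℓ}`. -/
def twistSum (n r : ℕ) (ℓ : ℤ) : Module.End ℂ (TensorPow n r) :=
  ∑ a ∈ Finset.range r, twistCoeff r n ℓ a • (tensorF n r ^ a * tensorE n r ^ a)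

/-- The recursion that composes the winding of the first strand (`b` powers) with the full twist of
the others (`d` powers), the latter in degree `ℓ - b`. -/
theorem twistCoeff_rec {r n : ℕ} (hr : 2 ≤ r) (ℓ : ℤ) {d b : ℕ} (h : d + b < r) :
    windCoeff r n ℓ b * twistCoeff r n (ℓ - b) d = twistCoeff r (n + 1) ℓ (d + b) *
      (gauss r d b * qHalf r ^ (-2 * (d : ℤ) * ((r : ℤ) - 1 - 2 * (0 : ℕ)))) := by
  have h0 := qHalf_ne_zero r
  have h1 := qNumFactorial_ne_zero hr (by omega : d < r)
  have h2 := qNumFactorial_ne_zero hr (by omega : b < r)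
  have h3 := qNumFactorial_ne_zero hr h
  rw [gauss_eq hr h, windCoeff, twistCoeff, twistCoeff]
  have key : qHalf r ^ (2 * ((r : ℤ) - 1) * (b - 2 * ℓ - n * b) + 4 * ℓ * b - 3 * b ^ 2 - b) *
      qHalf r ^ (2 * ((r : ℤ) - 1) * (n * (d - 2 * (ℓ - b))) + d ^ 2 + 3 * d - 4 * (ℓ - b) * d +
        4 * (ℓ - b) * (ℓ - b - 1)) =
      qHalf r ^ (2 * ((r : ℤ) - 1) * ((n + 1 : ℕ) * ((d + b : ℕ) - 2 * ℓ)) + ((d + b : ℕ) : ℤ) ^ 2 +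
        3 * (d + b : ℕ) - 4 * ℓ * (d + b : ℕ) + 4 * ℓ * (ℓ - 1)) *
      (qHalf r ^ (2 * (d : ℤ) * b) * qHalf r ^ (-2 * (d : ℤ) * ((r : ℤ) - 1 - 2 * (0 : ℕ)))) := by
    simp only [← zpow_add₀ h0]
    push_cast
    congr 1
    ring
  field_simp
  linear_combination (qNum r 1 ^ (2 * (d + b))) * key

/-- The condition on the coefficients for `∑ t_a F^a E^a` to commute with `F`, the degree being `ℓ`
before `F` and `ℓ + 1` after. -/
theorem twistCoeff_tensorF_rec {r n : ℕ} (hr : 2 ≤ r) (ℓ : ℤ) {a : ℕ} (ha : a + 1 < r) :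
    twistCoeff r n (ℓ + 1) a + twistCoeff r n (ℓ + 1) (a + 1) *
      (qInt r (a + 1) * qInt r (n * ((r : ℤ) - 1) - 2 * ℓ + a)) = twistCoeff r n ℓ a := by
  have h0 := qHalf_ne_zero r
  have h1 := qNum_one_ne_zero hr
  have h2 : qNum r (a + 1) ≠ 0 := qNum_ne_zero hr (by omega) (by omega)
  have h3 := qNumFactorial_ne_zero hr (by omega : a < r)
  have hs : twistCoeff r n (ℓ + 1) (a + 1) *
      (qInt r (a + 1) * qInt r (n * ((r : ℤ) - 1) - 2 * ℓ + a)) =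
      qNum r 1 ^ (2 * a) / qNumFactorial r a *
        (qHalf r ^ (2 * ((r : ℤ) - 1) * (n * ((a + 1 : ℕ) - 2 * (ℓ + 1))) + (a + 1 : ℕ) ^ 2 +
          3 * (a + 1 : ℕ) - 4 * (ℓ + 1) * (a + 1 : ℕ) + 4 * (ℓ + 1) * (ℓ + 1 - 1)) *
          qNum r (n * ((r : ℤ) - 1) - 2 * ℓ + a)) := by
    rw [twistCoeff, qNumFactorial_succ, qInt, qInt]
    field_simp
    ring
  rw [hs, twistCoeff, twistCoeff, ← mul_add]
  congr 1
  rw [qNum_eq, mul_sub (qHalf r ^ _), ← zpow_add₀ h0, ← zpow_add₀ h0]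
  push_cast
  ring_nf

theorem tensorF_twistSum {n r : ℕ} (hr : 2 ≤ r) {ℓ : ℤ} {x : TensorPow n r}
    (hx : x ∈ degreeSpace n r ℓ) :
    twistSum n r (ℓ + 1) (tensorF n r x) = tensorF n r (twistSum n r ℓ x) := by
  obtain ⟨t, rfl⟩ : ∃ t, r = t + 1 := ⟨r - 1, by omega⟩
  -- The truncation at `a < r` is consistent because the would-be top terms contain `F^r = 0`.
  have hF : (tensorF n (t + 1)) ((tensorF n (t + 1) ^ t) ((tensorE n (t + 1) ^ t) x)) = 0 := by
    rw [← Module.End.mul_apply, ← pow_succ', tensorF_pow_self hr]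
    rfl
  have hF' : (tensorF n (t + 1) ^ t) (tensorF n (t + 1) ((tensorE n (t + 1) ^ t) x)) = 0 := by
    rw [← Module.End.mul_apply, ← pow_succ, tensorF_pow_self hr]
    rfl
  simp only [twistSum, LinearMap.sum_apply, LinearMap.smul_apply, Module.End.mul_apply, map_sum,
    map_smul]
  rw [Finset.sum_range_succ', Finset.sum_range_succ _ t, hF, smul_zero, add_zero]
  simp only [tensorE_pow_tensorF hr hx, map_add, map_smul, smul_add, smul_smul,
    Finset.sum_add_distrib]
  have h1 : ∑ a ∈ Finset.range t, twistCoeff (t + 1) n (ℓ + 1) (a + 1) •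
      (tensorF n (t + 1) ^ (a + 1)) (tensorF n (t + 1) ((tensorE n (t + 1) ^ (a + 1)) x)) +
      twistCoeff (t + 1) n (ℓ + 1) 0 • (tensorF n (t + 1) ^ 0)
        ((tensorE n (t + 1) ^ 0) (tensorF n (t + 1) x)) =
      ∑ a ∈ Finset.range t, twistCoeff (t + 1) n (ℓ + 1) a •
        (tensorF n (t + 1) ^ (a + 1)) ((tensorE n (t + 1) ^ a) x) := by
    have := Finset.sum_range_succ' (fun a => twistCoeff (t + 1) n (ℓ + 1) a •
      (tensorF n (t + 1) ^ a) (tensorF n (t + 1) ((tensorE n (t + 1) ^ a) x))) t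
    rw [Finset.sum_range_succ, hF', smul_zero, add_zero] at this
    simp only [pow_succ _ _, Module.End.mul_apply, pow_zero, Module.End.one_apply] at this ⊢
    exact this.symm
  rw [add_right_comm, h1, ← Finset.sum_add_distrib]
  refine Finset.sum_congr rfl fun a ha => ?_
  rw [← add_smul, twistCoeff_tensorF_rec hr ℓ (by simpa using ha), pow_succ']
  rfl

theorem tensorE_pow_cons_u_zero {n r : ℕ} (x : TensorPow n r) (a : ℕ) :
    (tensorE (n + 1) r ^ a) (cons (u r 0) x) = cons (u r 0) ((tensorE n r ^ a) x) := by
  induction a with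
  | zero => simp
  | succ a ih =>
    rw [pow_succ', Module.End.mul_apply, ih, tensorE_cons, opE_u_zero, pow_succ']
    simp

/-- On `u_0 ⊗ x`, `E` acts on `x` alone, so winding followed by the inner full twist matches the
`q`-binomial expansion of `F^c E^c`. Both sides intertwine `F`, which extends the equality from
`u_m` to `u_{m+1}`. -/
theorem fullTwistOp_apply {n r : ℕ} (hr : 2 ≤ r) {ℓ : ℤ} {x : TensorPow n r}
    (hx : x ∈ degreeSpace n r ℓ) : fullTwistOp n r x = twistSum n r ℓ x := by
  induction n generalizing ℓ with
  | zero =>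
    by_cases hℓ : ℓ = 0
    · subst hℓ
      simp only [twistSum, LinearMap.sum_apply]
      rw [Finset.sum_eq_single_of_mem 0 (by simp; omega)]
      · simp [fullTwistOp, halfTwistProd, twistCoeff, qNumFactorial_zero]
      · intro c _ hc
        simp [tensorE, sumInsert_zero_left, hc]
    · simp [eq_zero_of_mem_degreeSpace_zero hℓ hx]
  | succ n ih =>
    suffices key : ∀ m < r, ∀ ℓ, ∀ x ∈ degreeSpace n r (ℓ - m),
        fullTwistOp (n + 1) r (cons (u r m) x) = twistSum (n + 1) r ℓ (cons (u r m) x) from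
      degreeSpace_hom_ext _ _ (fun m hm x hx => key m hm ℓ x hx) hx
    clear hx x ℓ
    intro m hm ℓ x hx
    induction m generalizing ℓ x with
    | zero =>
      rw [Nat.cast_zero, sub_zero] at hx
      rw [fullTwistOp_succ_apply hr, windOp_cons hr hx]
      simp only [map_sum, map_smul, shift_fullTwistOp_cons]
      have hih : ∀ c : ℕ, fullTwistOp n r ((tensorE n r ^ c) x) =
          ∑ d ∈ Finset.range r, twistCoeff r n (ℓ - c) d •
            (tensorF n r ^ d) ((tensorE n r ^ (d + c)) x) := by
        intro c
        rw [ih (tensorE_pow_mem hx c)]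
        simp [twistSum, pow_add]
      simp only [hih, map_sum, map_smul, Finset.smul_sum, twistSum, LinearMap.sum_apply,
        LinearMap.smul_apply, Module.End.mul_apply, tensorE_pow_cons_u_zero, tensorF_pow_cons hr]
      rw [Finset.sum_comm, sum_range_range_eq_sum_antidiagonal]
      · refine Finset.sum_congr rfl fun c hc => Finset.sum_congr rfl fun p hp => ?_
        rw [Finset.HasAntidiagonal.mem_antidiagonal] at hp
        rw [Finset.mem_range] at hc
        have := twistCoeff_rec (n := n) hr ℓ (d := p.1) (b := p.2) (by omega)
        rw [hp] at this
        simp only [smul_smul]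
        rw [this, hp, mul_assoc]
      · intro a b hab
        obtain ⟨t, ht⟩ := Nat.exists_eq_add_of_le hab
        rw [ht, pow_add, tensorE_pow_self hr]
        simp
    | succ m ihm =>
      have hx' : x ∈ degreeSpace n r (ℓ - 1 - m) := by
        rwa [show ℓ - 1 - (m : ℤ) = ℓ - (m + 1 : ℕ) by push_cast; ring]
      have hFx : tensorF n r x ∈ degreeSpace n r (ℓ - m) := by
        have := tensorF_mem hr hx'
        rwa [show ℓ - 1 - (m : ℤ) + 1 = ℓ - m by ring] at this
      have h1 := ihm (by omega) (ℓ - 1) x hx'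
      have h2 := ihm (by omega) ℓ (tensorF n r x) hFx
      have hmem := cons_mem_degreeSpace (by omega : m < r) hx'
      rw [show (m : ℤ) + (ℓ - 1 - m) = ℓ - 1 by ring] at hmem
      have h3 := tensorF_twistSum hr hmem
      rw [sub_add_cancel, ← h1] at h3
      have h4 := LinearMap.congr_fun (commute_fullTwistOp_tensorF (n := n + 1) hr).eq
        (cons (u r m) x)
      simp only [Module.End.mul_apply] at h4
      rw [← h3] at h4
      simp only [tensorF_cons, opF_u hr, opKInv_sq_u, map_add, map_smul, LinearMap.smul_apply,
        h2] at h4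
      have hne : qInt r (m + 1) ^ 2 ≠ 0 := by
        refine pow_ne_zero _ fun h => ?_
        rw [qInt, div_eq_zero_iff] at h
        exact h.elim (qNum_ne_zero hr (by omega) (by omega)) (qNum_one_ne_zero hr)
      exact smul_right_injective _ hne (add_right_cancel h4)

end Steinberg

end

/-! ### A telescoping `q`-identity and the twist on the kernel of `(FE)²` -/

noncomputable section

/-- `∑_{a=1}^{J} (1 - Q^J)(1 - Q^{J-1}) ⋯ (1 - Q^{J-a+1}) / (1 - Q^a) = J`. -/
theorem sum_prod_one_sub_pow_div {K : Type*} [Field K] (Q : K) (J : ℕ)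
    (hQ : ∀ a < J, Q ^ (a + 1) ≠ 1) :
    ∑ a ∈ Finset.range J, (∏ i ∈ Finset.range (a + 1), (1 - Q ^ (J - i))) / (1 - Q ^ (a + 1)) =
      J := by
  induction J with
  | zero => simp
  | succ J ih =>
    have hz : ∏ i ∈ Finset.range (J + 1), (1 - Q ^ (J - i)) = 0 := by
      rw [Finset.prod_range_succ]
      simp
    -- Passing from `J` to `J + 1` changes each term by a difference of consecutive products. The
    -- differences telescope to `1`, as the last product contains `1 - Q^0`.
    have hterm : ∀ a ∈ Finset.range (J + 1),
        (∏ i ∈ Finset.range (a + 1), (1 - Q ^ (J + 1 - i))) / (1 - Q ^ (a + 1)) =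
        (∏ i ∈ Finset.range (a + 1), (1 - Q ^ (J - i))) / (1 - Q ^ (a + 1)) +
        (∏ i ∈ Finset.range a, (1 - Q ^ (J - i)) -
          ∏ i ∈ Finset.range (a + 1), (1 - Q ^ (J - i))) := by
      intro a ha
      rw [Finset.mem_range] at ha
      have hne : 1 - Q ^ (a + 1) ≠ 0 := sub_ne_zero.2 (hQ a ha).symm
      have hpow : Q ^ (J - a) * Q ^ (a + 1) = Q ^ (J + 1) := by
        rw [← pow_add]
        congr 1
        omega
      have hsh : ∏ i ∈ Finset.range (a + 1), (1 - Q ^ (J + 1 - i)) =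
          (∏ i ∈ Finset.range a, (1 - Q ^ (J - i))) * (1 - Q ^ (J + 1)) := by
        rw [Finset.prod_range_succ']
        simp
      rw [hsh, Finset.prod_range_succ, ← hpow]
      field_simp
      ring
    rw [Finset.sum_congr rfl hterm, Finset.sum_add_distrib, Finset.sum_range_sub',
      Finset.sum_range_succ, ih fun a ha => hQ a (by omega), hz]
    simp

namespace Steinberg

/-- This is `sum_prod_one_sub_pow_div` at `Q = q⁻²` and `J = j + 1`, after multiplying by `{j+1}`,
which completes the product. Terms with `a > j` contain the factor `{0}`. -/
theorem sum_prod_qNum_div {r j : ℕ} (hr : 2 ≤ r) (hj : j + 1 < r) :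
    ∑ a ∈ Finset.range (r - 1), qHalf r ^ (((a : ℤ) + 1) * (a - 2 * j)) *
      (∏ i ∈ Finset.range a, qNum r (j - i)) / qNum r (a + 1) = (j + 1) / qNum r (j + 1) := by
  have h0 := qHalf_ne_zero r
  have hJ : qNum r (j + 1) ≠ 0 := qNum_ne_zero hr (by omega) (by omega)
  have hsub : Finset.range (j + 1) ⊆ Finset.range (r - 1) := Finset.range_mono (by omega)
  rw [← Finset.sum_subset hsub, eq_div_iff hJ, Finset.sum_mul]
  · have hq : ∀ x : ℤ, qNum r x = qHalf r ^ (2 * x) * (1 - qHalf r ^ (-4 * x)) := by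
      intro x
      rw [qNum_eq, mul_sub, mul_one, ← zpow_add₀ h0]
      congr 2
      ring
    have hQ : ∀ x : ℕ, qHalf r ^ (-4 * (x : ℤ)) = (qHalf r ^ (-4 : ℤ)) ^ x := by
      intro x
      rw [zpow_mul, zpow_natCast]
    have hmain := sum_prod_one_sub_pow_div (qHalf r ^ (-4 : ℤ)) (j + 1) (by
      intro a ha h
      rw [← hQ, qHalf_zpow_eq_one_iff hr] at h
      obtain ⟨c, hc⟩ := h
      push_cast at hc
      have : (r : ℤ) ∣ a + 1 := ⟨-c, by linarith⟩
      have := Int.le_of_dvd (by omega) this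
      omega)
    push_cast at hmain
    rw [← hmain]
    refine Finset.sum_congr rfl fun a ha => ?_
    rw [Finset.mem_range] at ha
    have hprod : ∀ b ≤ j + 1, ∏ i ∈ Finset.range b, qNum r ((j : ℤ) + 1 - i) =
        qHalf r ^ (2 * ((j : ℤ) + 1) * b - b * (b - 1)) *
          ∏ i ∈ Finset.range b, (1 - (qHalf r ^ (-4 : ℤ)) ^ (j + 1 - i)) := by
      intro b hb
      induction b with
      | zero => simp
      | succ b ih =>
        rw [Finset.prod_range_succ, Finset.prod_range_succ, ih (by omega), hq, ← hQ]
        rw [show qHalf r ^ (2 * ((j : ℤ) + 1) * (b + 1 : ℕ) - (b + 1 : ℕ) * ((b + 1 : ℕ) - 1)) =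
          qHalf r ^ (2 * ((j : ℤ) + 1) * b - b * (b - 1)) * qHalf r ^ (2 * ((j : ℤ) + 1 - b)) by
            rw [← zpow_add₀ h0]; push_cast; congr 1; ring]
        push_cast [show b ≤ j + 1 by omega]
        ring
    have h1 : (∏ i ∈ Finset.range a, qNum r ((j : ℤ) - i)) * qNum r (j + 1) =
        ∏ i ∈ Finset.range (a + 1), qNum r ((j : ℤ) + 1 - i) := by
      rw [Finset.prod_range_succ']
      refine congrArg₂ _ (Finset.prod_congr rfl fun i _ => ?_) (by simp)
      congr 1
      push_cast
      ring
    have h2 : qNum r (a + 1) ≠ 0 := qNum_ne_zero hr (by omega) (by omega)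
    have h3 := hq (a + 1)
    have h4 := hQ (a + 1)
    push_cast at h4
    rw [h4] at h3
    have h5 : 1 - (qHalf r ^ (-4 : ℤ)) ^ (a + 1) ≠ 0 := by
      intro h
      rw [h, mul_zero] at h3
      exact h2 h3
    rw [div_mul_eq_mul_div, mul_assoc, h1, hprod (a + 1) (by omega), h3, ← mul_assoc,
      ← zpow_add₀ h0, mul_div_mul_comm, ← zpow_sub₀ h0]
    convert one_mul _ using 2
    rw [← zpow_zero (qHalf r)]
    congr 1
    push_cast
    ring
  · intro a _ ha
    rw [Finset.mem_range] at ha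
    rw [Finset.prod_eq_zero (i := j) (by simp; omega) (by simp [qNum])]
    simp

/-! ### `F^a E^a` on the kernel of `(FE)²` -/

/-- Commute `F` past `E^{a+1}` on `E x`, whose weight is `n(r-1) - 2(ℓ-1)`. On `ker (FE)²` the first
term drops out, leaving a scalar recursion. -/
theorem pow_tensorF_tensorE_succ {n r : ℕ} (hr : 2 ≤ r) {ℓ : ℤ} {x : TensorPow n r}
    (hx : x ∈ degreeSpace n r ℓ) (a : ℕ) :
    (tensorF n r ^ (a + 2)) ((tensorE n r ^ (a + 2)) x) =
      (tensorF n r ^ (a + 1)) ((tensorE n r ^ (a + 1)) (tensorF n r (tensorE n r x))) -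
      (qInt r (a + 1) * qInt r (n * ((r : ℤ) - 1) - 2 * (ℓ - 1) + a)) •
        (tensorF n r ^ (a + 1)) ((tensorE n r ^ (a + 1)) x) := by
  rw [tensorE_pow_tensorF hr (tensorE_mem hx), map_add, map_smul, pow_succ (tensorF n r) (a + 1),
    pow_succ (tensorE n r) (a + 1), pow_succ (tensorE n r) a]
  simp only [Module.End.mul_apply, add_sub_cancel_right]

theorem pow_tensorF_tensorE_eq_zero {n r : ℕ} (hr : 2 ≤ r) {ℓ : ℤ} {x : TensorPow n r}
    (hx : x ∈ degreeSpace n r ℓ) (h : tensorF n r (tensorE n r x) = 0) (a : ℕ) :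
    (tensorF n r ^ (a + 1)) ((tensorE n r ^ (a + 1)) x) = 0 := by
  induction a with
  | zero => simpa using h
  | succ a ih =>
    rw [pow_tensorF_tensorE_succ hr hx, h, ih]
    simp

theorem pow_tensorF_tensorE {n r : ℕ} (hr : 2 ≤ r) {ℓ : ℤ} {x : TensorPow n r}
    (hx : x ∈ degreeSpace n r ℓ)
    (h : tensorF n r (tensorE n r (tensorF n r (tensorE n r x))) = 0) (a : ℕ) :
    (tensorF n r ^ (a + 1)) ((tensorE n r ^ (a + 1)) x) =
      (∏ i ∈ Finset.range a, -(qInt r (i + 1) *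
        qInt r (n * ((r : ℤ) - 1) - 2 * (ℓ - 1) + i))) • tensorF n r (tensorE n r x) := by
  induction a with
  | zero => simp
  | succ a ih =>
    have hy := tensorF_mem hr (tensorE_mem hx)
    rw [pow_tensorF_tensorE_succ hr hx, pow_tensorF_tensorE_eq_zero hr hy h, ih,
      Finset.prod_range_succ, smul_smul, zero_sub, ← neg_smul]
    congr 1
    ring

theorem twistCoeff_zero {r : ℕ} (hr : 2 ≤ r) (n : ℕ) (ℓ : ℤ) :
    twistCoeff r n ℓ 0 = q r ^ (2 * ℓ * (n + ℓ - 1)) := by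
  -- The two exponents of `q^{1/2}` differ by `4rnℓ`, a multiple of its order.
  rw [q_zpow, ← qHalf_zpow_add_mul hr _ (-(n * ℓ))]
  simp only [twistCoeff, qNumFactorial_zero, mul_zero, pow_zero, div_one, one_mul, Nat.cast_zero]
  congr 1
  ring

theorem twistSum_apply_of_eq_zero {n r : ℕ} (hr : 2 ≤ r) {ℓ : ℤ} {x : TensorPow n r}
    (hx : x ∈ degreeSpace n r ℓ) (h : tensorF n r (tensorE n r x) = 0) :
    twistSum n r ℓ x = q r ^ (2 * ℓ * (n + ℓ - 1)) • x := by
  simp only [twistSum, LinearMap.sum_apply, LinearMap.smul_apply, Module.End.mul_apply]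
  rw [Finset.sum_eq_single_of_mem 0 (by simp; omega), twistCoeff_zero hr]
  · simp
  · intro a _ ha
    obtain ⟨a, rfl⟩ := Nat.exists_eq_succ_of_ne_zero ha
    rw [pow_tensorF_tensorE_eq_zero hr hx h, smul_zero]

theorem qNum_add_mul {r : ℕ} (hr : 2 ≤ r) (x t : ℤ) :
    qNum r (x + r * t) = qHalf r ^ (2 * r * t) * qNum r x := by
  have h0 := qHalf_ne_zero r
  have h := qHalf_zpow_add_mul hr (-(2 * (x + r * t))) t
  rw [qNum_eq, qNum_eq, mul_sub, ← zpow_add₀ h0, ← zpow_add₀ h0, ← h]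
  ring_nf

/-- Take `a = r - 1` in `pow_tensorF_tensorE`: the left side is zero since `E^r = 0`. For `i < r -
1`, neither `i + 1` nor `i - j` is divisible by `r`, so the scalar is nonzero. -/
theorem tensorF_tensorE_eq_zero {n r j : ℕ} (hr : 2 ≤ r) {ℓ t : ℤ} {x : TensorPow n r}
    (hx : x ∈ degreeSpace n r ℓ)
    (h : tensorF n r (tensorE n r (tensorF n r (tensorE n r x))) = 0)
    (ht : n * ((r : ℤ) - 1) - 2 * (ℓ - 1) = -j + r * t) (hj : j = r - 1) :
    tensorF n r (tensorE n r x) = 0 := by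
  have h1 := pow_tensorF_tensorE hr hx h (r - 1)
  rw [Nat.sub_add_cancel (by omega), tensorE_pow_self hr] at h1
  simp only [LinearMap.zero_apply, map_zero] at h1
  refine (smul_eq_zero.1 h1.symm).resolve_left ?_
  refine Finset.prod_ne_zero_iff.2 fun i hi => ?_
  rw [Finset.mem_range] at hi
  rw [neg_ne_zero, mul_ne_zero_iff, Ne, Ne, qInt_eq_zero_iff hr, qInt_eq_zero_iff hr, ht]
  constructor
  · intro hd
    have := Int.le_of_dvd (by omega) hd
    omega
  · intro hd
    have hd' : (r : ℤ) ∣ j - i := by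
      have := (dvd_sub (Dvd.intro t rfl : (r : ℤ) ∣ r * t) hd)
      rwa [show (r : ℤ) * t - (-j + r * t + i) = j - i by ring] at this
    have := Int.le_of_dvd (by omega) hd'
    omega

theorem twistSum_apply {n r j : ℕ} (hr : 2 ≤ r) {ℓ t : ℤ} {x : TensorPow n r}
    (hx : x ∈ degreeSpace n r ℓ)
    (h : tensorF n r (tensorE n r (tensorF n r (tensorE n r x))) = 0)
    (ht : n * ((r : ℤ) - 1) - 2 * (ℓ - 1) = -j + r * t) (hj : j + 1 < r) :
    twistSum n r ℓ x = q r ^ (2 * ℓ * (n + ℓ - 1)) • (x + (qHalf r ^ (2 * r * t) * (j + 1) *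
      (qNum r 1 ^ 2 / qNum r (j + 1))) • tensorF n r (tensorE n r x)) := by
  have h0 := qHalf_ne_zero r
  have h1 := qNum_one_ne_zero hr
  obtain ⟨k, rfl⟩ : ∃ k, r = k + 1 := ⟨r - 1, by omega⟩
  -- Each factor is `-[i+1][-j+i+rt] = q^{rt} [i+1][j-i]`: the sign is absorbed by oddness, and
  -- `q^{rt} = ±1` comes out.
  have hprod : ∀ a : ℕ, ∏ i ∈ Finset.range a, -(qInt (k + 1) (i + 1) *
      qInt (k + 1) (n * (((k + 1 : ℕ) : ℤ) - 1) - 2 * (ℓ - 1) + i)) =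
      (qHalf (k + 1) ^ (2 * (k + 1 : ℕ) * t)) ^ a * qNumFactorial (k + 1) a *
        (∏ i ∈ Finset.range a, qNum (k + 1) (j - i)) / qNum (k + 1) 1 ^ (2 * a) := by
    intro a
    induction a with
    | zero => simp [qNumFactorial_zero]
    | succ a ih =>
      have hneg : qNum (k + 1) (-(j : ℤ) + a) = -qNum (k + 1) (j - a) := by
        rw [qNum, qNum]
        ring_nf
      rw [Finset.prod_range_succ, ih, ht, show -(j : ℤ) + (k + 1 : ℕ) * t + a =
        (-(j : ℤ) + a) + (k + 1 : ℕ) * t by ring, qInt, qInt, qNum_add_mul hr, hneg,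
        qNumFactorial_succ, Finset.prod_range_succ]
      field_simp
      ring
  -- The factorial from the product cancels the one in the twist coefficient up to `{a+1}`, leaving
  -- the summand of `sum_prod_qNum_div`.
  have hcoeff : ∀ a ∈ Finset.range k, twistCoeff (k + 1) n ℓ (a + 1) *
      (∏ i ∈ Finset.range a, -(qInt (k + 1) (i + 1) *
      qInt (k + 1) (n * (((k + 1 : ℕ) : ℤ) - 1) - 2 * (ℓ - 1) + i))) =
      twistCoeff (k + 1) n ℓ 0 * (qHalf (k + 1) ^ (2 * (k + 1 : ℕ) * t) * qNum (k + 1) 1 ^ 2) *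
      (qHalf (k + 1) ^ (((a : ℤ) + 1) * (a - 2 * j)) *
      (∏ i ∈ Finset.range a, qNum (k + 1) (j - i)) / qNum (k + 1) (a + 1)) := by
    intro a ha
    rw [Finset.mem_range] at ha
    have h2 : qNum (k + 1) (a + 1) ≠ 0 := qNum_ne_zero hr (by omega) (by push_cast; omega)
    have h3 : qNumFactorial (k + 1) a ≠ 0 := qNumFactorial_ne_zero hr (by omega)
    -- Substituting `ht` reduces the exponent to the required one modulo `4r`; the sign `q^{rt}`
    -- raised to an even power disappears.
    have hexp : qHalf (k + 1) ^ (2 * (((k + 1 : ℕ) : ℤ) - 1) * (n * ((a + 1 : ℕ) - 2 * ℓ)) +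
        ((a + 1 : ℕ) : ℤ) ^ 2 + 3 * (a + 1 : ℕ) - 4 * ℓ * (a + 1 : ℕ) + 4 * ℓ * (ℓ - 1)) *
        (qHalf (k + 1) ^ (2 * (k + 1 : ℕ) * t)) ^ a =
        qHalf (k + 1) ^ (2 * (((k + 1 : ℕ) : ℤ) - 1) * (n * ((0 : ℕ) - 2 * ℓ)) +
        ((0 : ℕ) : ℤ) ^ 2 + 3 * (0 : ℕ) - 4 * ℓ * (0 : ℕ) + 4 * ℓ * (ℓ - 1)) *
        (qHalf (k + 1) ^ (2 * (k + 1 : ℕ) * t) *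
          qHalf (k + 1) ^ (((a : ℤ) + 1) * (a - 2 * j))) := by
      rw [← zpow_natCast (qHalf (k + 1) ^ _) a, ← zpow_mul]
      simp only [← zpow_add₀ h0]
      rw [← qHalf_zpow_add_mul hr _ (-(t * a))]
      congr 1
      push_cast at ht ⊢
      linear_combination (2 * ((a : ℤ) + 1)) * ht
    rw [hprod, twistCoeff, twistCoeff, qNumFactorial_succ, qNumFactorial_zero]
    field_simp
    linear_combination (qNum (k + 1) 1 ^ (2 * a + 2) *
      ∏ i ∈ Finset.range a, qNum (k + 1) (j - i)) * hexp
  have hsum := sum_prod_qNum_div hr hj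
  simp only [twistSum, LinearMap.sum_apply, LinearMap.smul_apply, Module.End.mul_apply]
  rw [Finset.sum_range_succ']
  simp only [pow_tensorF_tensorE hr hx h, smul_smul]
  rw [← Finset.sum_smul, Finset.sum_congr rfl hcoeff, ← Finset.mul_sum]
  rw [Nat.add_sub_cancel] at hsum
  rw [hsum, twistCoeff_zero hr, smul_add, smul_smul]
  simp only [pow_zero, Module.End.one_apply]
  module

end Steinberg

end

/-! ### Invariant subspaces and the main theorem -/

namespace Steinberg

theorem braidRep_mem_ker {n r : ℕ} (hr : 2 ≤ r) {A : Module.End ℂ (TensorPow n r)}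
    (hA : ∀ i, Commute (sigmaOp n r i) A) (g : BraidGroup n) {v : TensorPow n r}
    (hv : v ∈ LinearMap.ker A) : braidRep n hr g v ∈ LinearMap.ker A := by
  have := LinearMap.congr_fun (commute_braidRep hr hA g).eq v
  simp only [Module.End.mul_apply, LinearMap.mem_ker.1 hv, map_zero] at this
  exact this.symm

theorem braidRep_mem_weightSpace {n r ℓ : ℕ} (hr : 2 ≤ r) (g : BraidGroup n) {v : TensorPow n r}
    (hv : v ∈ weightSpace n r ℓ) : braidRep n hr g v ∈ weightSpace n r ℓ := by
  refine braidRep_mem_ker hr (fun i => LinearMap.ext fun x => ?_) g hv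
  have := LinearMap.congr_fun (commute_sigmaOp_tensorH hr i).eq x
  simp only [Module.End.mul_apply] at this
  simp [this]

end Steinberg

open Steinberg in
theorem mainTheorem2 (n r ℓ j : ℕ) (ℓ' : ℤ) (hn : 1 ≤ n) (hr : 2 ≤ r) (hjr : j < r)
    (hj : (j : ℤ) ≡ n + 2 * ((ℓ : ℤ) - 1) [ZMOD r]) (hℓ' : ℓ' = (ℓ : ℤ) - 1 - j) :
    ∃ ρ : Representation ℂ (BraidGroup n) (TensorPow n r),
      (∀ i, ρ (BraidGroup.gen n i) = sigmaOp n r i) ∧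
      ∃ W N : Subrepresentation ρ,
        W.toSubmodule = highestWeightSpace n r ℓ ∧
        N.toSubmodule = dominantSpace n r ℓ ∧
        -- the formula for the full twist on `N_{n,ℓ}`
        (j < r - 1 → ∀ v ∈ dominantSpace n r ℓ,
          ρ (BraidGroup.fullTwist n) v =
            q r ^ (2 * (ℓ : ℤ) * (n + ℓ - 1)) •
              (v + (s r ^ n * q r ^ (1 - (ℓ : ℤ) - ℓ') * ((ℓ : ℤ) - ℓ' : ℤ) *
                (qNum r 1 ^ 2 / qNum r (ℓ - ℓ'))) • tensorF n r (tensorE n r v))) ∧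
        -- if `j = r - 1`, then `{ℓ - ℓ'} = {r} = 0` and `FE` vanishes on `N_{n,ℓ}`
        (j = r - 1 → ∀ v ∈ dominantSpace n r ℓ,
          tensorF n r (tensorE n r v) = 0 ∧
          ρ (BraidGroup.fullTwist n) v = q r ^ (2 * (ℓ : ℤ) * (n + ℓ - 1)) • v) ∧
        -- the full twist acts on `W_{n,ℓ}` by a root of unity
        (∀ v ∈ highestWeightSpace n r ℓ,
          ρ (BraidGroup.fullTwist n) v = q r ^ (2 * (ℓ : ℤ) * (n + ℓ - 1)) • v) ∧
        (q r ^ (2 * (ℓ : ℤ) * (n + ℓ - 1))) ^ r = 1 ∧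
        W.toRepresentation (BraidGroup.fullTwist n ^ r) = 1 ∧
        (2 ≤ n → ¬ Function.Injective W.toRepresentation) := by
  have hE : ∀ i, Commute (sigmaOp n r i) (tensorE n r) := commute_sigmaOp_tensorE hr
  have hFE : ∀ i, Commute (sigmaOp n r i) ((tensorF n r * tensorE n r) ^ 2) := fun i =>
    ((commute_sigmaOp_tensorF hr i).mul_right (hE i)).pow_right 2
  let W : Subrepresentation (braidRep n hr) :=
    ⟨highestWeightSpace n r ℓ, fun g v hv =>
      ⟨braidRep_mem_ker hr hE g hv.1, braidRep_mem_weightSpace hr g hv.2⟩⟩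
  let N : Subrepresentation (braidRep n hr) :=
    ⟨dominantSpace n r ℓ, fun g v hv =>
      ⟨braidRep_mem_ker hr hFE g hv.1, braidRep_mem_weightSpace hr g hv.2⟩⟩
  -- The weight of `E v` is `-(n + 2(ℓ-1)) + nr`, hence `-j` modulo `r`; the quotient `t` governs
  -- the sign `q^{rt} = (-1)^t`.
  obtain ⟨t, ht⟩ : ∃ t : ℤ, n * ((r : ℤ) - 1) - 2 * (ℓ - 1) = -j + r * t := by
    obtain ⟨c, hc⟩ := Int.modEq_iff_dvd.1 hj
    exact ⟨n - c, by linear_combination -hc⟩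
  have hdeg : ∀ v ∈ weightSpace n r ℓ, v ∈ degreeSpace n r ℓ := fun v hv => by
    rwa [weightSpace_eq_degreeSpace] at hv
  have hker : ∀ v ∈ dominantSpace n r ℓ,
      tensorF n r (tensorE n r (tensorF n r (tensorE n r v))) = 0 := fun v hv => by
    simpa [pow_two] using LinearMap.mem_ker.1 hv.1
  have htwist : ∀ v ∈ weightSpace n r ℓ,
      braidRep n hr (BraidGroup.fullTwist n) v = twistSum n r ℓ v := fun v hv => by
    rw [braidRep_fullTwist, fullTwistOp_apply hr (hdeg v hv)]
  have hW : ∀ v ∈ highestWeightSpace n r ℓ, braidRep n hr (BraidGroup.fullTwist n) v =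
      q r ^ (2 * (ℓ : ℤ) * (n + ℓ - 1)) • v := fun v hv => by
    rw [htwist v hv.2, twistSum_apply_of_eq_zero hr (hdeg v hv.2)
      (by rw [LinearMap.mem_ker.1 hv.1, map_zero])]
  have hroot : (q r ^ (2 * (ℓ : ℤ) * (n + ℓ - 1))) ^ r = 1 := by
    rw [q_zpow, ← zpow_natCast, ← zpow_mul, qHalf_zpow_eq_one_iff hr]
    exact ⟨ℓ * (n + ℓ - 1), by ring⟩
  have htriv : W.toRepresentation (BraidGroup.fullTwist n ^ r) = 1 := by
    have hpow : ∀ k : ℕ, ∀ v ∈ highestWeightSpace n r ℓ,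
        braidRep n hr (BraidGroup.fullTwist n ^ k) v =
          (q r ^ (2 * (ℓ : ℤ) * (n + ℓ - 1))) ^ k • v := by
      intro k v hv
      induction k with
      | zero => simp
      | succ k ih => rw [pow_succ', map_mul, Module.End.mul_apply, ih, map_smul, hW v hv, smul_smul,
          ← pow_succ]
    ext v
    have := hpow r v v.2
    rw [hroot, one_smul] at this
    exact this
  refine ⟨braidRep n hr, braidRep_gen hr, W, N, rfl, rfl, ?_, ?_, hW, hroot, htriv, ?_⟩
  · intro hlt v hv
    rw [htwist v hv.2, twistSum_apply hr (hdeg v hv.2) (hker v hv) ht (by omega)]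
    have hdiff : (ℓ : ℤ) - ℓ' = j + 1 := by rw [hℓ']; ring
    -- With `ℓ' = ℓ - 1 - j`, the total exponent of `q` is `n(r-1) - 2(ℓ-1) + j = rt`.
    have hsign : s r ^ n * q r ^ (1 - (ℓ : ℤ) - ℓ') = qHalf r ^ (2 * r * t) := by
      rw [← zpow_natCast, s_zpow hr, q_zpow, ← zpow_add₀ (qHalf_ne_zero r), hℓ']
      congr 1
      linear_combination 2 * ht
    rw [hdiff, hsign]
    push_cast
    rfl
  · intro heq v hv
    have h0 := tensorF_tensorE_eq_zero hr (hdeg v hv.2) (hker v hv) ht heq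
    exact ⟨h0, by rw [htwist v hv.2, twistSum_apply_of_eq_zero hr (hdeg v hv.2) h0]⟩
  · intro hn2 hinj
    exact BraidGroup.fullTwist_pow_ne_one hn2 (by omega) (hinj (htriv.trans (map_one _).symm))
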